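/- Let $a,b>0$ with $(ab)^{-1}=n\in\mathbb N$. For $\gamma>0$ let $g_2(t)=C_{b,\gamma}\,e^{-\gamma t}\chi_{[0,2/b]}(t)$, where $C_{b,\gamma}>0$ is chosen such that $\|g_2\|_{L^2(\mathbb R)}=1$. Let $A(\gamma)$ and $B(\gamma)$ be the sharp frame bounds of the Gabor system $\mathcal G(g_2,a\mathbb Z\times b\mathbb Z)$, i.e. the largest $A$ and the smallest $B$ with $$A\|f\|_2^2\le\sum_{k,l\in\mathbb Z}\Big|\int_{\mathbb R}f(t)\,\overline{g_2(t-ak)}\,e^{-2\pi i b l t}\,dt\Big|^2\le B\|f\|_2^2\qquad\text{for all } f\in L^2(\mathbb R).$$ For every $\gamma>0$ the system is a frame ($0<A(\gamma)\le B(\gamma)<\infty$), and for every fixed lattice $a\mathbb Z\times b\mathbb Z$ as above the following hold. (i) $A$ has a unique maximum on $(0,\infty)$. It is attained at the unique positive solution $\gamma$ of $$-1+\frac1{\gamma a}-\coth(\gamma a)=-\,n\,\coth\Big(\frac{\gamma na}{2}\Big)\operatorname{sech}(\gamma na).$$ (ii) If $n\in\{1,2\}$, then $B(\gamma)>2n$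 and $B'(\gamma)>0$ for all $\gamma>0$. (iii) If $n\ge3$, then $B$ has on $(0,\infty)$ exactly one local maximum point $\gamma^*$ and exactly one local minimum point $\gamma_*$, and $$\gamma^*<\frac{\operatorname{arccosh}\big(\frac{1+\sqrt5}{2}\big)}{na}<\gamma_*.$$ If $B(\gamma_*)<2n$, then the minimum at $\gamma_*$ is global on $(0,\infty)$. Moreover $B'(\gamma)>0$ for all $\gamma>\gamma_*$. In (iii) the minimum may or may not be global: there are $a,b$ and $n\ge3$ as above for which $B$ attains a global minimum on $(0,\infty)$, and others for which it does not. -/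

import Mathlib

open MeasureTheory

namespace CutoffGabor

/-- Hyperbolic secant. -/
noncomputable def sech (x : ℝ) : ℝ := 1 / Real.cosh x

/-- Hyperbolic cotangent (used for `x ≠ 0` only). -/
noncomputable def coth (x : ℝ) : ℝ := Real.cosh x / Real.sinh x

/-- The time-frequency shift `M_ω T_x g`, that is `t ↦ g (t - x) e^{2πiωt}`. -/
noncomputable def timeFreqShift (g : ℝ → ℂ) (x ω : ℝ) (t : ℝ) : ℂ :=
  g (t - x) * Complex.exp (2 * Real.pi * Complex.I * ω * t)

/-- The inner product `⟨f, h⟩ = ∫ f(t) conj(h(t)) dt` of `L²(ℝ)`, linear in the first argument. -/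
noncomputable def innerL2 (f h : ℝ → ℂ) : ℂ :=
  ∫ t : ℝ, f t * (starRingEnd ℂ) (h t)

/-- `∑_{λ ∈ aℤ × bℤ} |⟨f, π(λ) g⟩|²`, as an element of `[0, ∞]`. -/
noncomputable def gaborSum (g : ℝ → ℂ) (a b : ℝ) (f : ℝ → ℂ) : ENNReal :=
  ∑' p : ℤ × ℤ, ‖innerL2 f (timeFreqShift g (a * p.1) (b * p.2))‖ₑ ^ 2

/-- `A ‖f‖² ≤ ∑_λ |⟨f, π(λ) g⟩|²` for every `f ∈ L²(ℝ)`. -/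
def IsLowerFrameBound (g : ℝ → ℂ) (a b A : ℝ) : Prop :=
  0 ≤ A ∧ ∀ f : ℝ → ℂ, MemLp f 2 volume →
    ENNReal.ofReal A * eLpNorm f 2 volume ^ 2 ≤ gaborSum g a b f

/-- `∑_λ |⟨f, π(λ) g⟩|² ≤ B ‖f‖²` for every `f ∈ L²(ℝ)`. -/
def IsUpperFrameBound (g : ℝ → ℂ) (a b B : ℝ) : Prop :=
  0 ≤ B ∧ ∀ f : ℝ → ℂ, MemLp f 2 volume →
    gaborSum g a b f ≤ ENNReal.ofReal B * eLpNorm f 2 volume ^ 2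

/-- The sharp (largest) lower frame bound of the Gabor system `G(g, aℤ × bℤ)`. -/
noncomputable def lowerFrameBound (g : ℝ → ℂ) (a b : ℝ) : ℝ :=
  sSup {A : ℝ | IsLowerFrameBound g a b A}

/-- The sharp (smallest) upper frame bound of the Gabor system `G(g, aℤ × bℤ)`. -/
noncomputable def upperFrameBound (g : ℝ → ℂ) (a b : ℝ) : ℝ :=
  sInf {B : ℝ | IsUpperFrameBound g a b B}

/-- The normalizing constant `C > 0` for which `t ↦ C e^{-γt} χ_{[0, m/b]}(t)` has `L²`-norm one. -/
noncomputable def normConst (m : ℕ) (b γ : ℝ) : ℝ :=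
  (Real.sqrt (∫ t in Set.Icc (0 : ℝ) (m / b), Real.exp (-γ * t) ^ 2))⁻¹

/-- The normalized cut-off exponential `g_m(t) = C e^{-γt} χ_{[0, m/b]}(t)`. -/
noncomputable def cutoffExp (m : ℕ) (b γ : ℝ) (t : ℝ) : ℂ :=
  (((Set.Icc (0 : ℝ) (m / b)).indicator
    (fun s : ℝ => normConst m b γ * Real.exp (-γ * s)) t : ℝ) : ℂ)

/-- Sharp lower frame bound of `G(g₂, aℤ × bℤ)` as a function of the decay parameter `γ`. -/
noncomputable def lowerBound₂ (a b γ : ℝ) : ℝ := lowerFrameBound (cutoffExp 2 b γ) a b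

/-- Sharp upper frame bound of `G(g₂, aℤ × bℤ)` as a function of the decay parameter `γ`. -/
noncomputable def upperBound₂ (a b γ : ℝ) : ℝ := upperFrameBound (cutoffExp 2 b γ) a b

end CutoffGabor

/-! Put `L = 1/b = na` and `q = e^{-γL}`. The window covers two periods of the modulations, so
Parseval in `l` turns the Gabor sum into integrals of `|f(t) + q f(t + L)|²` against exponential
weights over `(ak, ak + L]`. Each such interval consists of `n` cells of length `a`. Regrouping by
cells gives a constant `K` times the integral of `|f + qTf|²`, with `T` the shift by `L`, against
the weight `e^{-2γ(t - ak)}` that restarts on every cell. The weight ranges over `[e^{-2γa}, 1)` and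
`1 + qT` has norm bounds `1 ± q`, so `K e^{-2γa}(1 - q)²` and `K(1 + q)²` are frame bounds. They are
sharp because both extremes can be approached at once: by step functions near one end of the cells,
with constant or alternating signs along steps of `L`. In `x = γa` this gives `A = nx(coth x - 1)(1
- sech nx)` and `B = nx(coth x + 1)(1 + sech nx)`.

The rest is the sign of logarithmic derivatives. That of `A` is strictly decreasing with one zero
(`strictAntiOn_lowerRate`, `exists_lowerRate_zero`). That of `B` is `decayRate x - n * sechRate (n *
x)`. It is positive for `n ≤ 2`, by `decayRate x ≥ 1/(1 + x)`. For `n ≥ 3` it changes sign exactly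
twice (`exists_upperRate_sign`): it decreases until `cosh nx` is the golden ratio, where `sechRate`
peaks; it is negative for a while after that; and then its product with `e^{x/2}` increases. Since
`B → 2n` at `0⁺`, whether the minimum is global depends on comparison with `2n`; `n = 8` and `n = 3`
show both outcomes. -/

namespace CutoffGabor

/-! ### Parseval and the fibre form of the Gabor sum -/

theorem tsum_setLIntegral_cells {a : ℝ} (ha : 0 < a) (F : ℝ → ENNReal) :
    ∑' k : ℤ, ∫⁻ t in Set.Ioc (a * k) (a * (k + 1)), F t = ∫⁻ t, F t := by
  have h1 := iUnion_Ioc_zsmul ha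
  have h2 := Set.pairwise_disjoint_Ioc_zsmul a
  simp only [zsmul_eq_mul, Int.cast_add, Int.cast_one, mul_comm _ a] at h1 h2
  rw [← lintegral_iUnion (fun _ => measurableSet_Ioc) h2, h1, Measure.restrict_univ]

theorem setLIntegral_Ioc_split (F : ℝ → ENNReal) {a : ℝ} (ha : 0 ≤ a) (x : ℝ) (n : ℕ) :
    ∫⁻ t in Set.Ioc x (x + n * a), F t =
      ∑ r ∈ Finset.range n, ∫⁻ t in Set.Ioc (x + r * a) (x + (r + 1) * a), F t := by
  induction n with
  | zero => simp
  | succ n ih =>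
    rw [Finset.sum_range_succ, ← ih, ← lintegral_union measurableSet_Ioc, Set.Ioc_union_Ioc_eq_Ioc]
    · push_cast; rfl
    · nlinarith [Nat.cast_nonneg (α := ℝ) n]
    · nlinarith
    · rw [Set.disjoint_left]
      intro t h1 h2
      exact absurd h1.2 (not_le.2 h2.1)

/-- Parseval on an interval of length `L`: the integrals are `L` times the normalized Fourier
coefficients, and `L²` against the factor `1/L` in Parseval leaves `L`. -/
theorem tsum_sq_integral_mul_exp {L : ℝ} (hL : 0 < L) (x : ℝ) {h : ℝ → ℂ}
    (hh : MemLp h 2 (volume.restrict (Set.Ioc x (x + L)))) :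
    ∑' l : ℤ, ‖∫ t in Set.Ioc x (x + L),
        h t * Complex.exp (-(2 * Real.pi * Complex.I * (l / L : ℝ) * t))‖ₑ ^ 2 =
      ENNReal.ofReal L * ∫⁻ t in Set.Ioc x (x + L), ‖h t‖ₑ ^ 2 := by
  have hab : x < x + L := by linarith
  have key := hasSum_sq_fourierCoeffOn hab hh
  have e1 : ∀ l : ℤ, ‖∫ t in Set.Ioc x (x + L),
        h t * Complex.exp (-(2 * Real.pi * Complex.I * (l / L : ℝ) * t))‖ₑ ^ 2 =
      ENNReal.ofReal (L ^ 2 * ‖fourierCoeffOn hab h l‖ ^ 2) := by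
    intro l
    rw [fourierCoeffOn_eq_integral, intervalIntegral.integral_of_le hab.le]
    have : ∀ t : ℝ, fourier (-l) (t : AddCircle (x + L - x)) • h t =
        h t * Complex.exp (-(2 * Real.pi * Complex.I * (l / L : ℝ) * t)) := by
      intro t
      rw [fourier_coe_apply, smul_eq_mul, mul_comm]
      congr 2
      push_cast
      ring
    simp only [this, add_sub_cancel_left]
    rw [norm_smul, mul_pow, ← mul_assoc, Real.norm_of_nonneg (by positivity), ← mul_pow,
      mul_one_div_cancel hL.ne', one_pow, one_mul, ENNReal.ofReal_pow (norm_nonneg _),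
      ofReal_norm]
  simp_rw [e1]
  rw [← ENNReal.ofReal_tsum_of_nonneg (fun _ => by positivity) (key.summable.mul_left _),
    tsum_mul_left, key.tsum_eq, intervalIntegral.integral_of_le hab.le]
  have : ∫⁻ t in Set.Ioc x (x + L), ‖h t‖ₑ ^ 2 =
      ENNReal.ofReal (∫ t in Set.Ioc x (x + L), ‖h t‖ ^ 2) := by
    rw [ofReal_integral_eq_lintegral_ofReal]
    · refine lintegral_congr fun t => ?_
      rw [ENNReal.ofReal_pow (norm_nonneg _), ofReal_norm]
    · exact hh.integrable_norm_pow (by norm_num)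
    · exact Filter.Eventually.of_forall fun _ => by positivity
  rw [this, ← ENNReal.ofReal_mul hL.le, add_sub_cancel_left, smul_eq_mul]
  congr 1
  field_simp

theorem normConst_sq {m : ℕ} (hm : 0 < m) {b γ : ℝ} (hb : 0 < b) (hγ : 0 < γ) :
    normConst m b γ ^ 2 = 2 * γ / (1 - Real.exp (-(2 * γ * (m / b)))) := by
  have hm' : (0 : ℝ) < m / b := by positivity
  have h1 : ∫ t in Set.Icc (0 : ℝ) (m / b), Real.exp (-γ * t) ^ 2 =
      (1 - Real.exp (-(2 * γ * (m / b)))) / (2 * γ) := by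
    rw [integral_Icc_eq_integral_Ioc, ← intervalIntegral.integral_of_le hm'.le]
    have : ∀ t : ℝ, Real.exp (-γ * t) ^ 2 = Real.exp ((-(2 * γ)) * t) := by
      intro t
      rw [← Real.exp_nat_mul]
      congr 1
      push_cast
      ring
    simp_rw [this]
    rw [intervalIntegral.integral_comp_mul_left (fun t => Real.exp t) (by linarith : -(2 * γ) ≠ 0)]
    rw [integral_exp]
    simp only [mul_zero, Real.exp_zero, smul_eq_mul]
    field_simp
    ring_nf
  have h2 : Real.exp (-(2 * γ * (m / b))) < 1 := by
    rw [Real.exp_lt_one_iff]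
    have : 0 < 2 * γ * (m / b) := by positivity
    linarith
  rw [normConst, h1, inv_pow, Real.sq_sqrt (by apply div_nonneg <;> linarith), inv_div]

theorem normConst_pos {m : ℕ} (hm : 0 < m) {b γ : ℝ} (hb : 0 < b) (hγ : 0 < γ) :
    0 < normConst m b γ ^ 2 := by
  rw [normConst_sq hm hb hγ]
  have h2 : Real.exp (-(2 * γ * (m / b))) < 1 := by
    rw [Real.exp_lt_one_iff]
    have : 0 < 2 * γ * (m / b) := by positivity
    linarith
  exact div_pos (by positivity) (by linarith)

/-- The modulation has period `b⁻¹` and the exponential shrinks by a fixed factor over one period,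
so the second half of the support folds onto the first. -/
theorem innerL2_cutoffExp_two {b γ : ℝ} (hb : 0 < b) {f : ℝ → ℂ} (hf : MemLp f 2 volume)
    (x : ℝ) (l : ℤ) :
    innerL2 f (timeFreqShift (cutoffExp 2 b γ) x (b * l)) =
      ∫ t in Set.Ioc x (x + b⁻¹),
        ((normConst 2 b γ * Real.exp (-γ * (t - x)) : ℝ) *
          (f t + (Real.exp (-γ * b⁻¹) : ℝ) * f (t + b⁻¹))) *
        Complex.exp (-(2 * Real.pi * Complex.I * (l / b⁻¹ : ℝ) * t)) := by
  set G : ℝ → ℂ := fun t => f t * ((normConst 2 b γ * Real.exp (-γ * (t - x)) : ℝ) *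
    Complex.exp (-(2 * Real.pi * Complex.I * (l / b⁻¹ : ℝ) * t))) with hG
  have hbi : 0 < b⁻¹ := inv_pos.2 hb
  have hint : ∀ c d : ℝ, IntervalIntegrable G volume c d := by
    intro c d
    refine IntervalIntegrable.mul_continuousOn ?_ (by fun_prop)
    exact ((hf.locallyIntegrable (by norm_num)).integrableOn_isCompact
      isCompact_uIcc).intervalIntegrable
  have e1 : innerL2 f (timeFreqShift (cutoffExp 2 b γ) x (b * l)) =
      ∫ t in x..(x + b⁻¹ + b⁻¹), G t := by
    rw [intervalIntegral.integral_of_le (by linarith), ← integral_Icc_eq_integral_Ioc,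
      ← integral_indicator measurableSet_Icc, innerL2]
    refine integral_congr_ae (Filter.Eventually.of_forall fun t => ?_)
    have hmem : t - x ∈ Set.Icc (0 : ℝ) ((2 : ℕ) / b) ↔ t ∈ Set.Icc x (x + b⁻¹ + b⁻¹) := by
      have : ((2 : ℕ) : ℝ) / b = b⁻¹ + b⁻¹ := by push_cast; ring
      rw [this, Set.mem_Icc, Set.mem_Icc]
      constructor <;> rintro ⟨h1, h2⟩ <;> constructor <;> linarith
    simp only [timeFreqShift, cutoffExp]
    by_cases ht : t ∈ Set.Icc x (x + b⁻¹ + b⁻¹)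
    · rw [Set.indicator_of_mem ht, Set.indicator_of_mem (hmem.2 ht)]
      simp only [hG, map_mul, Complex.conj_ofReal, ← Complex.exp_conj, Complex.conj_I, div_inv_eq_mul,
        map_ofNat]
      congr 3
      push_cast
      ring
    · rw [Set.indicator_of_notMem ht, Set.indicator_of_notMem (fun h => ht (hmem.1 h))]
      simp
  rw [e1, ← intervalIntegral.integral_add_adjacent_intervals (hint x (x + b⁻¹)) (hint _ _),
    ← intervalIntegral.integral_comp_add_right G b⁻¹,
    ← intervalIntegral.integral_add (hint _ _), intervalIntegral.integral_of_le (by linarith)]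
  · refine integral_congr_ae (Filter.Eventually.of_forall fun t => ?_)
    have h1 : Complex.exp (-(2 * Real.pi * Complex.I * (l / b⁻¹ : ℝ) * (t + b⁻¹ : ℝ))) =
        Complex.exp (-(2 * Real.pi * Complex.I * (l / b⁻¹ : ℝ) * t)) := by
      rw [Complex.exp_eq_exp_iff_exists_int]
      refine ⟨-l, ?_⟩
      have : (b : ℂ) ≠ 0 := by exact_mod_cast hb.ne'
      push_cast
      field_simp
      ring
    have h2 : Real.exp (-γ * (t + b⁻¹ - x)) = Real.exp (-γ * (t - x)) * Real.exp (-γ * b⁻¹) := by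
      rw [← Real.exp_add]
      congr 1
      ring
    simp only [hG, h1, h2]
    push_cast
    ring
  · have := (hint (x + b⁻¹) (x + b⁻¹ + b⁻¹)).comp_add_right b⁻¹
    simpa using this

/-- The function `|f(t) + q f(t + L)|²` with `q = e^{-γL}`. -/
noncomputable def fibreSq (L γ : ℝ) (f : ℝ → ℂ) (t : ℝ) : ENNReal :=
  ‖f t + (Real.exp (-γ * L) : ℝ) * f (t + L)‖ₑ ^ 2

/-- The `r`-th cell of the `k`-th translate is cell `k + r` of the line, with its own weight
multiplied by `e^{-2γra}`. Summing over all `k` makes the shift by `r` invisible, so the sum over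
`r` splits off as a constant. -/
theorem gaborSum_cutoffExp_two {a b γ : ℝ} {n : ℕ} (ha : 0 < a) (hb : 0 < b)
    (hab : b⁻¹ = n * a) {f : ℝ → ℂ} (hf : MemLp f 2 volume) :
    gaborSum (cutoffExp 2 b γ) a b f =
      ENNReal.ofReal (b⁻¹ * normConst 2 b γ ^ 2 *
        ∑ r ∈ Finset.range n, Real.exp (-(2 * γ * (r * a)))) *
      ∑' k : ℤ, ∫⁻ t in Set.Ioc (a * k) (a * (k + 1)),
        ENNReal.ofReal (Real.exp (-(2 * γ * (t - a * k)))) * fibreSq b⁻¹ γ f t := by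
  have hbi : 0 < b⁻¹ := inv_pos.2 hb
  have step1 : ∀ k : ℤ, ∑' l : ℤ, ‖innerL2 f (timeFreqShift (cutoffExp 2 b γ) (a * k) (b * l))‖ₑ ^ 2
      = ENNReal.ofReal b⁻¹ * ∫⁻ t in Set.Ioc (a * k) (a * k + b⁻¹),
        ENNReal.ofReal (normConst 2 b γ ^ 2 * Real.exp (-(2 * γ * (t - a * k)))) *
          fibreSq b⁻¹ γ f t := by
    intro k
    simp_rw [innerL2_cutoffExp_two hb hf]
    rw [tsum_sq_integral_mul_exp hbi]
    · congr 1
      refine lintegral_congr fun t => ?_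
      rw [fibreSq, enorm_mul, mul_pow]
      congr 1
      rw [← ofReal_norm, Complex.norm_real, ← ENNReal.ofReal_pow (norm_nonneg _), Real.norm_eq_abs,
        sq_abs, mul_pow, ← Real.exp_nat_mul]
      congr 3
      push_cast
      ring
    · have hf2 : MemLp (fun t => f t + (Real.exp (-γ * b⁻¹) : ℝ) * f (t + b⁻¹)) 2 volume :=
        hf.add ((hf.comp_measurePreserving (measurePreserving_add_right volume b⁻¹)).const_mul _)
      -- The exponential factor is bounded on this bounded interval, so square integrability is
      -- inherited from `f` and its translate.
      refine MemLp.of_le_mul (c := |normConst 2 b γ| * Real.exp (|γ| * b⁻¹))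
        (hf2.restrict (Set.Ioc (a * k) (a * k + b⁻¹))) ?_ ?_
      · refine AEStronglyMeasurable.mul (Continuous.aestronglyMeasurable (by fun_prop))
          (hf2.restrict _).aestronglyMeasurable
      · refine (ae_restrict_iff' measurableSet_Ioc).2 (Filter.Eventually.of_forall fun t ht => ?_)
        rw [norm_mul, Complex.norm_real, norm_mul, Real.norm_eq_abs, Real.norm_eq_abs, Real.abs_exp]
        have h1 : |t - a * k| ≤ b⁻¹ := by
          rw [abs_le]
          constructor <;> linarith [ht.1, ht.2]
        have h2 : -γ * (t - a * k) ≤ |γ| * b⁻¹ := by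
          calc -γ * (t - a * k) ≤ |-γ * (t - a * k)| := le_abs_self _
            _ = |γ| * |t - a * k| := by rw [abs_mul, abs_neg]
            _ ≤ |γ| * b⁻¹ := by gcongr
        gcongr
  have step2 : ∀ (k : ℤ), ∫⁻ t in Set.Ioc (a * k) (a * k + b⁻¹),
        ENNReal.ofReal (normConst 2 b γ ^ 2 * Real.exp (-(2 * γ * (t - a * k)))) *
          fibreSq b⁻¹ γ f t =
      ENNReal.ofReal (normConst 2 b γ ^ 2) * ∑ r ∈ Finset.range n,
        ENNReal.ofReal (Real.exp (-(2 * γ * (r * a)))) *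
        ∫⁻ t in Set.Ioc (a * ((k + r : ℤ) : ℝ)) (a * ((k + r : ℤ) + 1)),
        ENNReal.ofReal (Real.exp (-(2 * γ * (t - a * ((k + r : ℤ) : ℝ))))) *
          fibreSq b⁻¹ γ f t := by
    intro k
    simp_rw [ENNReal.ofReal_mul (sq_nonneg (normConst 2 b γ)),
      mul_assoc (ENNReal.ofReal (normConst 2 b γ ^ 2))]
    rw [lintegral_const_mul' _ _ ENNReal.ofReal_ne_top, hab, setLIntegral_Ioc_split _ ha.le]
    congr 1
    refine Finset.sum_congr rfl fun r _ => ?_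
    rw [← lintegral_const_mul' _ _ ENNReal.ofReal_ne_top]
    have e1 : a * (k : ℝ) + r * a = a * ((k + r : ℤ) : ℝ) := by push_cast; ring
    have e2 : a * (k : ℝ) + (r + 1) * a = a * ((k + r : ℤ) + 1) := by push_cast; ring
    rw [e1, e2]
    refine lintegral_congr fun t => ?_
    rw [← mul_assoc, ← ENNReal.ofReal_mul (Real.exp_nonneg _), ← Real.exp_add]
    congr 4
    push_cast
    ring
  rw [gaborSum, ENNReal.tsum_prod
    (f := fun k l : ℤ => ‖innerL2 f (timeFreqShift (cutoffExp 2 b γ) (a * k) (b * l))‖ₑ ^ 2)]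
  simp_rw [step1, step2]
  rw [ENNReal.tsum_mul_left, ENNReal.tsum_mul_left,
    Summable.tsum_finsetSum (fun _ _ => ENNReal.summable)]
  have step3 : ∀ r : ℕ, ∑' k : ℤ, ENNReal.ofReal (Real.exp (-(2 * γ * (r * a)))) *
        ∫⁻ t in Set.Ioc (a * ((k + r : ℤ) : ℝ)) (a * ((k + r : ℤ) + 1)),
        ENNReal.ofReal (Real.exp (-(2 * γ * (t - a * ((k + r : ℤ) : ℝ))))) *
          fibreSq b⁻¹ γ f t = ENNReal.ofReal (Real.exp (-(2 * γ * (r * a)))) *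
        ∑' k : ℤ, ∫⁻ t in Set.Ioc (a * k) (a * (k + 1)),
        ENNReal.ofReal (Real.exp (-(2 * γ * (t - a * k)))) * fibreSq b⁻¹ γ f t := by
    intro r
    rw [ENNReal.tsum_mul_left]
    congr 1
    exact (Equiv.addRight (r : ℤ)).tsum_eq (fun k : ℤ => ∫⁻ t in Set.Ioc (a * k) (a * (k + 1)),
        ENNReal.ofReal (Real.exp (-(2 * γ * (t - a * k)))) * fibreSq b⁻¹ γ f t)
  simp_rw [step3]
  rw [← Finset.sum_mul, ENNReal.ofReal_mul (by positivity), ENNReal.ofReal_mul (by positivity),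
    ENNReal.ofReal_sum_of_nonneg (fun _ _ => Real.exp_nonneg _)]
  ring

/-! ### Norm bounds for `1 + qT` and the resulting frame bounds -/

theorem eLpNorm_two_sq (f : ℝ → ℂ) : eLpNorm f 2 volume ^ 2 = ∫⁻ t, ‖f t‖ₑ ^ 2 := by
  have := eLpNorm_nnreal_pow_eq_lintegral (μ := volume) (f := f) (p := 2) (by norm_num)
  simpa using this

theorem eLpNorm_comp_add_right {f : ℝ → ℂ} (hf : MemLp f 2 volume) (L : ℝ) :
    eLpNorm (fun t => f (t + L)) 2 volume = eLpNorm f 2 volume :=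
  eLpNorm_comp_measurePreserving hf.1 (measurePreserving_add_right volume L)

theorem lintegral_fibreSq_le (L γ : ℝ) {f : ℝ → ℂ} (hf : MemLp f 2 volume) :
    ∫⁻ t, fibreSq L γ f t ≤
      ENNReal.ofReal ((1 + Real.exp (-γ * L)) ^ 2) * eLpNorm f 2 volume ^ 2 := by
  have hT : MemLp (fun t => f (t + L)) 2 volume :=
    hf.comp_measurePreserving (measurePreserving_add_right volume L)
  set q := Real.exp (-γ * L) with hq
  have hq0 : 0 < q := Real.exp_pos _
  have h1 : eLpNorm (f + (q : ℂ) • fun t => f (t + L)) 2 volume ≤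
      ENNReal.ofReal (1 + q) * eLpNorm f 2 volume := by
    refine (eLpNorm_add_le hf.1 (hT.const_smul _).1 (by norm_num)).trans_eq ?_
    rw [eLpNorm_const_smul, eLpNorm_comp_add_right hf, ← ofReal_norm, Complex.norm_real,
      Real.norm_of_nonneg hq0.le, ENNReal.ofReal_add zero_le_one hq0.le, ENNReal.ofReal_one,
      add_mul, one_mul]
  have h2 := pow_le_pow_left₀ zero_le h1 2
  rwa [mul_pow, ← ENNReal.ofReal_pow (by positivity), eLpNorm_two_sq] at h2

theorem le_lintegral_fibreSq {L γ : ℝ} (hL : 0 < L) (hγ : 0 < γ) {f : ℝ → ℂ}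
    (hf : MemLp f 2 volume) :
    ENNReal.ofReal ((1 - Real.exp (-γ * L)) ^ 2) * eLpNorm f 2 volume ^ 2 ≤
      ∫⁻ t, fibreSq L γ f t := by
  have hT : MemLp (fun t => f (t + L)) 2 volume :=
    hf.comp_measurePreserving (measurePreserving_add_right volume L)
  set q := Real.exp (-γ * L) with hq
  have hq0 : 0 < q := Real.exp_pos _
  have hq1 : q < 1 := by
    rw [hq, Real.exp_lt_one_iff]
    nlinarith
  have h1 : ENNReal.ofReal (1 - q) * eLpNorm f 2 volume ≤
      eLpNorm (f + (q : ℂ) • fun t => f (t + L)) 2 volume := by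
    -- Reverse triangle inequality; finiteness of the norm lets truncated subtraction distribute
    -- over the product.
    rw [ENNReal.ofReal_sub _ hq0.le, ENNReal.ofReal_one, ENNReal.sub_mul (fun _ _ => hf.2.ne),
      one_mul, tsub_le_iff_right]
    have h3 : f = (f + (q : ℂ) • fun t => f (t + L)) - (q : ℂ) • fun t => f (t + L) := by simp
    conv_lhs => rw [h3]
    refine (eLpNorm_sub_le (hf.add (hT.const_smul _)).1 (hT.const_smul _).1
      (by norm_num)).trans_eq ?_
    rw [eLpNorm_const_smul, eLpNorm_comp_add_right hf, ← ofReal_norm, Complex.norm_real,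
      Real.norm_of_nonneg hq0.le]
  have h2 := pow_le_pow_left₀ zero_le h1 2
  rwa [mul_pow, ← ENNReal.ofReal_pow (by linarith), eLpNorm_two_sq (f + _)] at h2

/-- The constant `b⁻¹ C² ∑_{r<n} e^{-2γra}` in the fibre form of the Gabor sum. -/
noncomputable def fibreConst (a b γ : ℝ) (n : ℕ) : ℝ :=
  b⁻¹ * normConst 2 b γ ^ 2 * ∑ r ∈ Finset.range n, Real.exp (-(2 * γ * (r * a)))

theorem fibreConst_pos {a b γ : ℝ} {n : ℕ} (hn : 0 < n) (hb : 0 < b) (hγ : 0 < γ) :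
    0 < fibreConst a b γ n := by
  refine mul_pos (mul_pos (inv_pos.2 hb) (normConst_pos two_pos hb hγ)) ?_
  exact Finset.sum_pos (fun _ _ => Real.exp_pos _) (Finset.nonempty_range_iff.2 hn.ne')

section

variable {a b γ : ℝ} {n : ℕ}

theorem isUpperFrameBound_cutoffExp_two (ha : 0 < a) (hb : 0 < b) (hγ : 0 < γ) (hn : 0 < n)
    (hab : b⁻¹ = n * a) :
    IsUpperFrameBound (cutoffExp 2 b γ) a b
      (fibreConst a b γ n * (1 + Real.exp (-γ * b⁻¹)) ^ 2) := by
  have hK := fibreConst_pos (a := a) hn hb hγ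
  refine ⟨by positivity, fun f hf => ?_⟩
  rw [gaborSum_cutoffExp_two ha hb hab hf, ← fibreConst, ENNReal.ofReal_mul hK.le, mul_assoc]
  gcongr
  refine le_trans ?_ (lintegral_fibreSq_le b⁻¹ γ hf)
  rw [← tsum_setLIntegral_cells ha]
  -- On each cell the weight is at most 1, its limit at the left end.
  refine ENNReal.tsum_le_tsum fun k => setLIntegral_mono' measurableSet_Ioc fun t ht => ?_
  refine mul_le_of_le_one_left zero_le ?_
  rw [ENNReal.ofReal_le_one, Real.exp_le_one_iff]
  nlinarith [ht.1, mul_pos hγ (sub_pos.2 ht.1)]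

theorem isLowerFrameBound_cutoffExp_two (ha : 0 < a) (hb : 0 < b) (hγ : 0 < γ) (hn : 0 < n)
    (hab : b⁻¹ = n * a) :
    IsLowerFrameBound (cutoffExp 2 b γ) a b
      (fibreConst a b γ n * (Real.exp (-(2 * γ * a)) * (1 - Real.exp (-γ * b⁻¹)) ^ 2)) := by
  have hK := fibreConst_pos (a := a) hn hb hγ
  refine ⟨by positivity, fun f hf => ?_⟩
  rw [gaborSum_cutoffExp_two ha hb hab hf, ← fibreConst, ENNReal.ofReal_mul hK.le,
    ENNReal.ofReal_mul (Real.exp_nonneg _), mul_assoc, mul_assoc]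
  gcongr
  refine (mul_le_mul_right (le_lintegral_fibreSq (inv_pos.2 hb) hγ hf) _).trans ?_
  rw [← tsum_setLIntegral_cells ha, ← ENNReal.tsum_mul_left]
  -- On each cell the weight is at least `e^{-2γa}`, its value at the right end.
  refine ENNReal.tsum_le_tsum fun k => ?_
  rw [← lintegral_const_mul' _ _ ENNReal.ofReal_ne_top]
  refine setLIntegral_mono' measurableSet_Ioc fun t ht => ?_
  gcongr
  nlinarith [ht.2]

/-! ### Test functions and sharpness of the bounds -/

/-- The function equal to `c k` on `ak + (α, β]` for each `k`, and to `0` elsewhere. -/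
noncomputable def cellFun (a α β : ℝ) (c : ℤ → ℝ) (t : ℝ) : ℂ :=
  if t - a * ((⌈t / a⌉ - 1 : ℤ) : ℝ) ∈ Set.Ioc α β then (c (⌈t / a⌉ - 1) : ℂ) else 0

theorem ceil_div_sub_one_eq (ha : 0 < a) {t : ℝ} {k : ℤ} (ht : t ∈ Set.Ioc (a * k) (a * (k + 1))) :
    ⌈t / a⌉ - 1 = k := by
  have : ⌈t / a⌉ = k + 1 := by
    rw [Int.ceil_eq_iff]
    push_cast
    refine ⟨?_, ?_⟩
    · rw [lt_div_iff₀ ha]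
      linarith [ht.1]
    · rw [div_le_iff₀ ha]
      linarith [ht.2]
  omega

theorem cellFun_of_mem (ha : 0 < a) {α β : ℝ} (c : ℤ → ℝ) {t : ℝ} {k : ℤ}
    (ht : t ∈ Set.Ioc (a * k) (a * (k + 1))) :
    cellFun a α β c t = if t - a * k ∈ Set.Ioc α β then (c k : ℂ) else 0 := by
  simp only [cellFun, ceil_div_sub_one_eq ha ht]

theorem measurable_cellFun (a α β : ℝ) (c : ℤ → ℝ) : Measurable (cellFun a α β c) := by
  have h1 : Measurable fun t : ℝ => ⌈t / a⌉ - 1 :=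
    (measurable_from_top (f := fun k : ℤ => k - 1)).comp
      (Int.measurable_ceil.comp (measurable_id.div_const a))
  refine Measurable.ite ?_ ?_ measurable_const
  · refine measurableSet_Ioc.preimage ?_
    exact measurable_id.sub ((measurable_from_top (f := fun k : ℤ => a * (k : ℝ))).comp h1)
  · exact (measurable_from_top (f := fun k : ℤ => (c k : ℂ))).comp h1

theorem setLIntegral_cell_ite {α β : ℝ} (hα : 0 ≤ α) (hβ : β ≤ a) (k : ℤ) (v : ENNReal)
    {w : ℝ → ENNReal} (hw : Measurable w) :
    ∫⁻ t in Set.Ioc (a * k) (a * (k + 1)), w (t - a * k) *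
      (if t - a * k ∈ Set.Ioc α β then v else 0) = v * ∫⁻ s in Set.Ioc α β, w s := by
  have h1 : ∀ t, (Set.Ioc (a * (k : ℝ)) (a * (k + 1))).indicator (fun t => w (t - a * k) *
      (if t - a * k ∈ Set.Ioc α β then v else 0)) t =
      (Set.Ioc α β).indicator (fun s => v * w s) (t - a * k) := by
    intro t
    by_cases h : t - a * k ∈ Set.Ioc α β
    · rw [Set.indicator_of_mem h, Set.indicator_of_mem, if_pos h, mul_comm]
      exact ⟨by linarith [h.1], by linarith [h.2]⟩
    · rw [Set.indicator_of_notMem h, Set.indicator_apply, if_neg h, mul_zero, ite_self]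
  rw [← lintegral_indicator measurableSet_Ioc]
  simp_rw [h1]
  rw [lintegral_sub_right_eq_self (fun s => (Set.Ioc α β).indicator (fun s => v * w s) s),
    lintegral_indicator measurableSet_Ioc, lintegral_const_mul _ hw]

theorem eLpNorm_cellFun_sq (ha : 0 < a) {α β : ℝ} (hα : 0 ≤ α) (hβ : β ≤ a) (c : ℤ → ℝ) :
    eLpNorm (cellFun a α β c) 2 volume ^ 2 =
      (∑' k : ℤ, ENNReal.ofReal (c k ^ 2)) * ENNReal.ofReal (β - α) := by
  rw [eLpNorm_two_sq, ← tsum_setLIntegral_cells ha, ← ENNReal.tsum_mul_right]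
  refine tsum_congr fun k => ?_
  have := setLIntegral_cell_ite hα hβ k (ENNReal.ofReal (c k ^ 2)) (w := 1) measurable_one
  simp only [Pi.one_apply, one_mul, lintegral_const, MeasurableSet.univ,
    Measure.restrict_apply, Set.univ_inter, Real.volume_Ioc] at this
  rw [← this]
  refine setLIntegral_congr_fun measurableSet_Ioc fun t ht => ?_
  simp only [cellFun_of_mem ha c ht]
  split_ifs
  · rw [← ofReal_norm, Complex.norm_real, ← ENNReal.ofReal_pow (norm_nonneg _), Real.norm_eq_abs,
      sq_abs]
  · simp

/-- Since `b⁻¹ = na`, the points `t` and `t + b⁻¹` have the same position in cells `k` and `k + n`.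
The sum therefore factors into a sequence part and a weight part, which can be optimized separately.
-/
theorem gaborSum_cellFun (ha : 0 < a) (hb : 0 < b) (hab : b⁻¹ = n * a)
    {α β : ℝ} (hα : 0 ≤ α) (hβ : β ≤ a) (c : ℤ → ℝ)
    (hf : MemLp (cellFun a α β c) 2 volume) :
    gaborSum (cutoffExp 2 b γ) a b (cellFun a α β c) =
      ENNReal.ofReal (fibreConst a b γ n) *
        ((∑' k : ℤ, ENNReal.ofReal ((c k + Real.exp (-γ * b⁻¹) * c (k + n)) ^ 2)) *
          ∫⁻ s in Set.Ioc α β, ENNReal.ofReal (Real.exp (-(2 * γ * s)))) := by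
  rw [gaborSum_cutoffExp_two ha hb hab hf, ← fibreConst, ← ENNReal.tsum_mul_right]
  congr 1
  refine tsum_congr fun k => ?_
  rw [← setLIntegral_cell_ite hα hβ k _
    (w := fun s => ENNReal.ofReal (Real.exp (-(2 * γ * s)))) (by fun_prop)]
  refine setLIntegral_congr_fun measurableSet_Ioc fun t ht => ?_
  have ht' : t + b⁻¹ ∈ Set.Ioc (a * ((k + n : ℤ) : ℝ)) (a * ((k + n : ℤ) + 1)) := by
    rw [hab]
    push_cast
    exact ⟨by linarith [ht.1], by linarith [ht.2]⟩
  have e : t + b⁻¹ - a * ((k + n : ℤ) : ℝ) = t - a * k := by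
    rw [hab]
    push_cast
    ring
  simp only [fibreSq, cellFun_of_mem ha c ht, cellFun_of_mem ha c ht', e]
  congr 1
  split_ifs
  · rw [← Complex.ofReal_mul, ← Complex.ofReal_add, ← ofReal_norm, Complex.norm_real,
      ← ENNReal.ofReal_pow (norm_nonneg _), Real.norm_eq_abs, sq_abs]
  · simp

/-- The sequence with values `ε^j` at `nj`, `0 ≤ j < N`, and zero elsewhere. -/
noncomputable def stepSeq (n N : ℕ) (ε : ℝ) (k : ℤ) : ℝ :=
  if (n : ℤ) ∣ k ∧ 0 ≤ k / n ∧ k / n < N then ε ^ (k / n) else 0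

theorem tsum_eq_tsum_mul_of_dvd (hn : 0 < n) {F : ℤ → ENNReal}
    (hF : ∀ k, ¬ (n : ℤ) ∣ k → F k = 0) : ∑' k, F k = ∑' j : ℤ, F (n * j) := by
  refine (Function.Injective.tsum_eq (g := fun j : ℤ => (n : ℤ) * j) ?_ ?_).symm
  · exact mul_right_injective₀ (by exact_mod_cast hn.ne')
  · intro k hk
    by_contra h
    exact hk (hF k fun ⟨j, hj⟩ => h ⟨j, hj.symm⟩)

theorem stepSeq_mul (hn : 0 < n) (N : ℕ) (ε : ℝ) (j : ℤ) :
    stepSeq n N ε (n * j) = if 0 ≤ j ∧ j < N then ε ^ j else 0 := by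
  have : (n : ℤ) ≠ 0 := by exact_mod_cast hn.ne'
  simp [stepSeq, Int.mul_ediv_cancel_left _ this]

theorem stepSeq_of_not_dvd (N : ℕ) (ε : ℝ) {k : ℤ} (hk : ¬ (n : ℤ) ∣ k) :
    stepSeq n N ε k = 0 := by
  simp [stepSeq, hk]

theorem tsum_stepSeq_sq (hn : 0 < n) (N : ℕ) {ε : ℝ} (hε : ε ^ 2 = 1) :
    ∑' k : ℤ, ENNReal.ofReal (stepSeq n N ε k ^ 2) = ENNReal.ofReal N := by
  rw [tsum_eq_tsum_mul_of_dvd hn (fun k hk => by simp [stepSeq_of_not_dvd N ε hk]),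
    tsum_eq_sum (s := Finset.Ico (0 : ℤ) N)]
  · rw [Finset.sum_congr rfl (g := fun _ => 1)]
    · simp
    · intro j hj
      rw [stepSeq_mul hn, if_pos (Finset.mem_Ico.1 hj), ← zpow_natCast, ← zpow_mul, mul_comm,
        zpow_mul, zpow_natCast, hε, one_zpow, ENNReal.ofReal_one]
  · intro j hj
    rw [stepSeq_mul hn, if_neg (fun h => hj (Finset.mem_Ico.2 h))]
    simp

theorem sq_zpow_add_mul_zpow {ε : ℝ} (hε : ε ^ 2 = 1) (q : ℝ) (j : ℤ) :
    (ε ^ j + q * ε ^ (j + 1)) ^ 2 = (1 + q * ε) ^ 2 := by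
  have h0 : ε ≠ 0 := by
    rintro rfl
    norm_num at hε
  have : (ε ^ j) ^ 2 = 1 := by
    rw [← zpow_natCast, ← zpow_mul, mul_comm, zpow_mul, zpow_natCast, hε, one_zpow]
  rw [zpow_add_one₀ h0]
  calc _ = (ε ^ j) ^ 2 * (1 + q * ε) ^ 2 := by ring
    _ = _ := by rw [this, one_mul]

/-- The `N + 1` nonzero entries form `N` consecutive pairs, each contributing `(1 + qε)²`; the
boundary terms are dropped. The sign `ε = 1` serves the upper bound. -/
theorem le_tsum_stepSeq_fibre (hn : 0 < n) (N : ℕ) {ε : ℝ} (hε : ε ^ 2 = 1) (q : ℝ) :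
    ENNReal.ofReal (N * (1 + q * ε) ^ 2) ≤ ∑' k : ℤ, ENNReal.ofReal
      ((stepSeq n (N + 1) ε k + q * stepSeq n (N + 1) ε (k + n)) ^ 2) := by
  rw [tsum_eq_tsum_mul_of_dvd hn (fun k hk => by
    rw [stepSeq_of_not_dvd _ ε hk, stepSeq_of_not_dvd _ ε (by rwa [dvd_add_self_right])]; simp)]
  refine le_trans ?_ (ENNReal.sum_le_tsum (Finset.Ico (0 : ℤ) N))
  rw [Finset.sum_congr rfl (g := fun _ => ENNReal.ofReal ((1 + q * ε) ^ 2))]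
  · rw [ENNReal.ofReal_mul (by positivity)]
    simp
  · intro j hj
    rw [Finset.mem_Ico] at hj
    rw [← mul_add_one, stepSeq_mul hn, stepSeq_mul hn, if_pos (by push_cast; omega),
      if_pos (by push_cast; omega), sq_zpow_add_mul_zpow hε]

/-- Besides the `N` full pairs only the indices `-1` and `N` contribute, namely `q² ≤ 1` and `1`;
this is the extra 2. The sign `ε = -1` serves the lower bound. -/
theorem tsum_stepSeq_fibre_le (hn : 0 < n) (N : ℕ) {ε : ℝ} (hε : ε ^ 2 = 1) {q : ℝ}
    (hq0 : 0 ≤ q) (hq1 : q ≤ 1) :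
    ∑' k : ℤ, ENNReal.ofReal
      ((stepSeq n (N + 1) ε k + q * stepSeq n (N + 1) ε (k + n)) ^ 2) ≤
      ENNReal.ofReal (N * (1 + q * ε) ^ 2 + 2) := by
  rw [tsum_eq_tsum_mul_of_dvd hn (fun k hk => by
    rw [stepSeq_of_not_dvd _ ε hk, stepSeq_of_not_dvd _ ε (by rwa [dvd_add_self_right])]; simp),
    tsum_eq_sum (s := insert (-1) (insert (N : ℤ) (Finset.Ico (0 : ℤ) N)))]
  · rw [Finset.sum_insert (by simp), Finset.sum_insert (by simp),
      Finset.sum_congr rfl (g := fun _ => ENNReal.ofReal ((1 + q * ε) ^ 2))]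
    · have h1 : (ε ^ (N : ℤ)) ^ 2 = 1 := by
        rw [← zpow_natCast, ← zpow_mul, mul_comm, zpow_mul, zpow_natCast (n := 2), hε, one_zpow]
      have h2 : q ^ 2 ≤ 1 := by nlinarith
      have e1 : stepSeq n (N + 1) ε (n * -1) = 0 := by
        rw [stepSeq_mul hn, if_neg (by omega)]
      have e2 : stepSeq n (N + 1) ε (n * -1 + n) = 1 := by
        have := stepSeq_mul hn (N + 1) ε 0
        simpa using this
      have e3 : stepSeq n (N + 1) ε (n * N) = ε ^ (N : ℤ) := by
        rw [stepSeq_mul hn, if_pos (by push_cast; omega)]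
      have e4 : stepSeq n (N + 1) ε (n * N + n) = 0 := by
        rw [← mul_add_one, stepSeq_mul hn, if_neg (by push_cast; omega)]
      rw [e1, e2, e3, e4, ENNReal.ofReal_add (by positivity) (by positivity),
        ENNReal.ofReal_mul (by positivity), ENNReal.ofReal_natCast]
      simp only [mul_zero, add_zero, zero_add, mul_one, h1, Finset.sum_const, Int.card_Ico,
        sub_zero, Int.toNat_natCast, nsmul_eq_mul]
      rw [← add_assoc, add_comm]
      gcongr
      rw [← ENNReal.ofReal_add (by positivity) zero_le_one]
      exact ENNReal.ofReal_le_ofReal (by linarith)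
    · intro j hj
      rw [Finset.mem_Ico] at hj
      rw [← mul_add_one, stepSeq_mul hn, stepSeq_mul hn, if_pos (by push_cast; omega),
        if_pos (by push_cast; omega), sq_zpow_add_mul_zpow hε]
  · intro j hj
    simp only [Finset.mem_insert, Finset.mem_Ico, not_or] at hj
    rw [← mul_add_one, stepSeq_mul hn, stepSeq_mul hn, if_neg (by push_cast; omega),
        if_neg (by push_cast; omega)]
    simp

theorem memLp_cellFun_stepSeq (ha : 0 < a) (hn : 0 < n) {α β : ℝ} (hα : 0 ≤ α) (hβ : β ≤ a)
    (N : ℕ) {ε : ℝ} (hε : ε ^ 2 = 1) : MemLp (cellFun a α β (stepSeq n N ε)) 2 volume := by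
  refine ⟨(measurable_cellFun _ _ _ _).aestronglyMeasurable, ?_⟩
  have h := eLpNorm_cellFun_sq ha hα hβ (stepSeq n N ε)
  rw [tsum_stepSeq_sq hn N hε] at h
  have h2 : eLpNorm (cellFun a α β (stepSeq n N ε)) 2 volume ^ 2 < ⊤ := by
    rw [h]
    exact ENNReal.mul_lt_top ENNReal.ofReal_lt_top ENNReal.ofReal_lt_top
  exact (ENNReal.pow_lt_top_iff.1 h2).resolve_right (by norm_num)

theorem setLIntegral_exp_le (hγ : 0 < γ) (α β : ℝ) :
    ∫⁻ s in Set.Ioc α β, ENNReal.ofReal (Real.exp (-(2 * γ * s))) ≤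
      ENNReal.ofReal (Real.exp (-(2 * γ * α)) * (β - α)) := by
  refine (setLIntegral_mono' (g := fun _ => ENNReal.ofReal (Real.exp (-(2 * γ * α))))
    measurableSet_Ioc fun t ht => ?_).trans ?_
  · gcongr
    exact ht.1.le
  · simp [ENNReal.ofReal_mul (Real.exp_nonneg _)]

theorem le_setLIntegral_exp (hγ : 0 < γ) (α β : ℝ) :
    ENNReal.ofReal (Real.exp (-(2 * γ * β)) * (β - α)) ≤
      ∫⁻ s in Set.Ioc α β, ENNReal.ofReal (Real.exp (-(2 * γ * s))) := by
  refine le_trans ?_ (setLIntegral_mono' (f := fun _ => ENNReal.ofReal (Real.exp (-(2 * γ * β))))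
    measurableSet_Ioc fun t ht => ?_)
  · simp [ENNReal.ofReal_mul (Real.exp_nonneg _)]
  · gcongr
    exact ht.2

theorem exp_neg_mul_inv_lt_one (hb : 0 < b) (hγ : 0 < γ) : Real.exp (-γ * b⁻¹) < 1 := by
  rw [Real.exp_lt_one_iff]
  have : 0 < γ * b⁻¹ := by positivity
  linarith

-- Alternating signs make `f + qTf` as small as possible, and support in the right ends `(α, a]`
-- makes the weight smallest. The boundary error vanishes as `N → ∞`, then the weight tends to
-- `e^{-2γa}` as `α → a`.
open Filter Topology in
theorem IsLowerFrameBound.le_fibreConst (ha : 0 < a) (hb : 0 < b) (hγ : 0 < γ) (hn : 0 < n)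
    (hab : b⁻¹ = n * a) {A : ℝ} (hA : IsLowerFrameBound (cutoffExp 2 b γ) a b A) :
    A ≤ fibreConst a b γ n * (Real.exp (-(2 * γ * a)) * (1 - Real.exp (-γ * b⁻¹)) ^ 2) := by
  have hK := fibreConst_pos (a := a) hn hb hγ
  set K := fibreConst a b γ n
  set q := Real.exp (-γ * b⁻¹) with hq
  have hq1 : q < 1 := exp_neg_mul_inv_lt_one hb hγ
  have key : ∀ (N : ℕ) (α : ℝ), 0 ≤ α → α < a →
      A ≤ K * (Real.exp (-(2 * γ * α)) * ((1 - q) ^ 2 + 2 * (1 / ((N : ℝ) + 1)))) := by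
    intro N α h0 h1
    have hmem := memLp_cellFun_stepSeq ha hn h0 le_rfl (N + 1) (neg_one_sq (R := ℝ))
    have h := hA.2 _ hmem
    rw [gaborSum_cellFun ha hb hab h0 le_rfl _ hmem, eLpNorm_cellFun_sq ha h0 le_rfl,
      tsum_stepSeq_sq hn _ (neg_one_sq (R := ℝ))] at h
    have h2 := h.trans (mul_le_mul_right (mul_le_mul'
      (tsum_stepSeq_fibre_le hn N (neg_one_sq (R := ℝ)) (Real.exp_nonneg _) hq1.le)
      (setLIntegral_exp_le hγ α a)) _)
    rw [← ENNReal.ofReal_mul (Nat.cast_nonneg _), ← ENNReal.ofReal_mul hA.1,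
      ← ENNReal.ofReal_mul (by positivity), ← ENNReal.ofReal_mul hK.le,
      ENNReal.ofReal_le_ofReal_iff
        (mul_nonneg hK.le (mul_nonneg (by positivity)
          (mul_nonneg (Real.exp_nonneg _) (by linarith))))] at h2
    have hpos : 0 < ((N + 1 : ℕ) : ℝ) * (a - α) := mul_pos (by positivity) (by linarith)
    refine le_of_mul_le_mul_right (h2.trans ?_) hpos
    have e : K * (Real.exp (-(2 * γ * α)) * ((1 - q) ^ 2 + 2 * (1 / ((N : ℝ) + 1)))) *
        (((N + 1 : ℕ) : ℝ) * (a - α)) =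
        K * (Real.exp (-(2 * γ * α)) * (((N + 1) * (1 - q) ^ 2 + 2) * (a - α))) := by
      have : (N : ℝ) + 1 ≠ 0 := by positivity
      push_cast
      field_simp
    rw [e, mul_left_comm (Real.exp _)]
    have : 0 ≤ a - α := by linarith
    refine mul_le_mul_of_nonneg_left ?_ hK.le
    refine mul_le_mul_of_nonneg_right ?_ (by positivity)
    simp only [← hq, mul_neg, mul_one, ← sub_eq_add_neg]
    nlinarith [sq_nonneg (1 - q)]
  have key2 : ∀ α : ℝ, 0 ≤ α → α < a → A ≤ K * (Real.exp (-(2 * γ * α)) * (1 - q) ^ 2) := by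
    intro α h0 h1
    have hl := ((((tendsto_one_div_add_atTop_nhds_zero_nat (𝕜 := ℝ)).const_mul 2).const_add
      ((1 - q) ^ 2)).const_mul (Real.exp (-(2 * γ * α)))).const_mul K
    rw [mul_zero, add_zero] at hl
    exact ge_of_tendsto' hl fun N => key N α h0 h1
  have hc : Continuous fun α : ℝ => K * (Real.exp (-(2 * γ * α)) * (1 - q) ^ 2) := by fun_prop
  refine ge_of_tendsto (x := 𝓝[<] a) ((hc.tendsto a).mono_left nhdsWithin_le_nhds) ?_
  filter_upwards [Ioo_mem_nhdsLT ha] with α hα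
  exact key2 α hα.1.le hα.2

-- Constant signs and support in the left ends `(0, β]`; first `N → ∞`, then `β → 0`.
open Filter Topology in
theorem IsUpperFrameBound.fibreConst_le (ha : 0 < a) (hb : 0 < b) (hγ : 0 < γ) (hn : 0 < n)
    (hab : b⁻¹ = n * a) {B : ℝ} (hB : IsUpperFrameBound (cutoffExp 2 b γ) a b B) :
    fibreConst a b γ n * (1 + Real.exp (-γ * b⁻¹)) ^ 2 ≤ B := by
  have hK := fibreConst_pos (a := a) hn hb hγ
  set K := fibreConst a b γ n
  set q := Real.exp (-γ * b⁻¹) with hq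
  have hq0 : 0 < q := Real.exp_pos _
  have key : ∀ (N : ℕ) (β : ℝ), 0 < β → β ≤ a →
      K * (Real.exp (-(2 * γ * β)) * ((1 + q) ^ 2 * (1 - 1 / ((N : ℝ) + 1)))) ≤ B := by
    intro N β h0 h1
    have hmem := memLp_cellFun_stepSeq ha hn le_rfl h1 (N + 1) (one_pow (M := ℝ) 2)
    have h := hB.2 _ hmem
    rw [gaborSum_cellFun ha hb hab le_rfl h1 _ hmem, eLpNorm_cellFun_sq ha le_rfl h1,
      tsum_stepSeq_sq hn _ (one_pow (M := ℝ) 2)] at h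
    have h2 := (mul_le_mul_right (mul_le_mul'
      (le_tsum_stepSeq_fibre hn N (one_pow (M := ℝ) 2) q)
      (le_setLIntegral_exp hγ 0 β)) _).trans h
    rw [← ENNReal.ofReal_mul (by positivity), ← ENNReal.ofReal_mul hK.le,
      ← ENNReal.ofReal_mul (Nat.cast_nonneg _), ← ENNReal.ofReal_mul hB.1,
      ENNReal.ofReal_le_ofReal_iff (mul_nonneg hB.1 (mul_nonneg (by positivity)
        (by linarith)))] at h2
    have hpos : 0 < ((N + 1 : ℕ) : ℝ) * (β - 0) := mul_pos (by positivity) (by linarith)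
    refine le_of_mul_le_mul_right (le_of_eq_of_le ?_ h2) hpos
    have : (N : ℝ) + 1 ≠ 0 := by positivity
    push_cast
    field_simp
    ring
  have key2 : ∀ β : ℝ, 0 < β → β ≤ a → K * (Real.exp (-(2 * γ * β)) * (1 + q) ^ 2) ≤ B := by
    intro β h0 h1
    have hl := ((((tendsto_one_div_add_atTop_nhds_zero_nat (𝕜 := ℝ)).const_sub 1).const_mul
      ((1 + q) ^ 2)).const_mul (Real.exp (-(2 * γ * β)))).const_mul K
    rw [sub_zero, mul_one] at hl
    exact le_of_tendsto' hl fun N => key N β h0 h1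
  have hc : Continuous fun β : ℝ => K * (Real.exp (-(2 * γ * β)) * (1 + q) ^ 2) := by fun_prop
  have hl := (hc.tendsto 0).mono_left (nhdsWithin_le_nhds (s := Set.Ioi 0))
  simp only [mul_zero, neg_zero, Real.exp_zero, one_mul] at hl
  refine le_of_tendsto hl ?_
  filter_upwards [Ioo_mem_nhdsGT ha] with β hβ
  exact key2 β hβ.1 hβ.2.le

/-! ### Closed form of the sharp bounds -/

/-- With `p = e^{-γa}` and `p^n = q`, the geometric sum is `(1 - q²)/(1 - p²)`. The normalization
supplies `1/(1 - q⁴)`, and `1 - q²` cancels. -/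
theorem fibreConst_eq (ha : 0 < a) (hb : 0 < b) (hγ : 0 < γ) (hn : 0 < n) (hab : b⁻¹ = n * a) :
    fibreConst a b γ n = 2 * (n * (γ * a)) /
      ((1 + Real.exp (-(n * (γ * a))) ^ 2) * (1 - Real.exp (-(γ * a)) ^ 2)) := by
  set p := Real.exp (-(γ * a)) with hp
  set q := Real.exp (-(n * (γ * a))) with hq
  have hq0 : 0 < q := Real.exp_pos _
  have hp0 : 0 < p := Real.exp_pos _
  have hp1 : p < 1 := Real.exp_lt_one_iff.2 (neg_neg_of_pos (by positivity))
  have hq1 : q < 1 := Real.exp_lt_one_iff.2 (neg_neg_of_pos (by positivity))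
  have hpn : p ^ n = q := by
    rw [hp, hq, ← Real.exp_nat_mul]
    ring_nf
  have e1 : ∑ r ∈ Finset.range n, Real.exp (-(2 * γ * (r * a))) = (1 - q ^ 2) / (1 - p ^ 2) := by
    have : ∀ r : ℕ, Real.exp (-(2 * γ * (r * a))) = (p ^ 2) ^ r := by
      intro r
      rw [hp, ← Real.exp_nat_mul, ← Real.exp_nat_mul]
      congr 1
      push_cast
      ring
    simp_rw [this]
    rw [geom_sum_eq (by nlinarith), ← hpn, ← pow_mul, ← pow_mul, mul_comm n 2, ← neg_div_neg_eq]
    ring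
  have e2 : Real.exp (-(2 * γ * ((2 : ℕ) / b))) = q ^ 4 := by
    rw [hq, ← Real.exp_nat_mul, div_eq_mul_inv, hab]
    congr 1
    push_cast
    ring
  rw [fibreConst, normConst_sq two_pos hb hγ, e1, e2, hab]
  have h1 : 1 - p ^ 2 ≠ 0 := by nlinarith
  have h2 : 1 - q ^ 2 ≠ 0 := by nlinarith
  have h3 : 1 - q ^ 4 ≠ 0 := by
    have : q ^ 2 < 1 := by nlinarith
    nlinarith
  have h4 : 1 + q ^ 2 ≠ 0 := by positivity
  field_simp
  ring

theorem coth_eq_exp {x : ℝ} :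
    coth x = (1 + Real.exp (-x) ^ 2) / (1 - Real.exp (-x) ^ 2) := by
  rw [coth, Real.cosh_eq, Real.sinh_eq, div_div_div_cancel_right₀ two_ne_zero]
  have h : Real.exp x = (Real.exp (-x))⁻¹ := by rw [Real.exp_neg, inv_inv]
  have h0 : Real.exp (-x) ≠ 0 := (Real.exp_pos _).ne'
  rw [h, ← mul_div_mul_right _ _ h0, add_mul, sub_mul, inv_mul_cancel₀ h0, sq]

theorem sech_eq_exp {x : ℝ} : sech x = 2 * Real.exp (-x) / (1 + Real.exp (-x) ^ 2) := by
  rw [sech, Real.cosh_eq]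
  have h : Real.exp x = (Real.exp (-x))⁻¹ := by rw [Real.exp_neg, inv_inv]
  have h0 : Real.exp (-x) ≠ 0 := (Real.exp_pos _).ne'
  rw [h]
  field_simp

/-- The sharp upper frame bound as a function of `x = γa`. -/
noncomputable def upperProfile (n : ℕ) (x : ℝ) : ℝ := n * x * (1 + coth x) * (1 + sech (n * x))

/-- The sharp lower frame bound as a function of `x = γa`. -/
noncomputable def lowerProfile (n : ℕ) (x : ℝ) : ℝ := n * x * (coth x - 1) * (1 - sech (n * x))

theorem fibreConst_mul_upper (ha : 0 < a) (hb : 0 < b) (hγ : 0 < γ) (hn : 0 < n)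
    (hab : b⁻¹ = n * a) :
    fibreConst a b γ n * (1 + Real.exp (-γ * b⁻¹)) ^ 2 = upperProfile n (γ * a) := by
  have e : -γ * b⁻¹ = -(n * (γ * a)) := by rw [hab]; ring
  rw [fibreConst_eq ha hb hγ hn hab, e, upperProfile, coth_eq_exp, sech_eq_exp]
  have hp1 : Real.exp (-(γ * a)) < 1 := Real.exp_lt_one_iff.2 (neg_neg_of_pos (by positivity))
  have hp0 := Real.exp_pos (-(γ * a))
  have h1 : 1 - Real.exp (-(γ * a)) ^ 2 ≠ 0 := by nlinarith
  have h2 : 1 + Real.exp (-(n * (γ * a))) ^ 2 ≠ 0 := by positivity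
  field_simp
  ring

/-- Here `2p²/(1 - p²) = coth x - 1` and `(1 - q)²/(1 + q²) = 1 - sech nx`. -/
theorem fibreConst_mul_lower (ha : 0 < a) (hb : 0 < b) (hγ : 0 < γ) (hn : 0 < n)
    (hab : b⁻¹ = n * a) :
    fibreConst a b γ n * (Real.exp (-(2 * γ * a)) * (1 - Real.exp (-γ * b⁻¹)) ^ 2) =
      lowerProfile n (γ * a) := by
  have e : -γ * b⁻¹ = -(n * (γ * a)) := by rw [hab]; ring
  have e2 : Real.exp (-(2 * γ * a)) = Real.exp (-(γ * a)) ^ 2 := by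
    rw [← Real.exp_nat_mul]
    congr 1
    push_cast
    ring
  rw [fibreConst_eq ha hb hγ hn hab, e, e2, lowerProfile, coth_eq_exp, sech_eq_exp]
  have hp1 : Real.exp (-(γ * a)) < 1 := Real.exp_lt_one_iff.2 (neg_neg_of_pos (by positivity))
  have hp0 := Real.exp_pos (-(γ * a))
  have h1 : 1 - Real.exp (-(γ * a)) ^ 2 ≠ 0 := by nlinarith
  have h2 : 1 + Real.exp (-(n * (γ * a))) ^ 2 ≠ 0 := by positivity
  field_simp
  ring

theorem isGreatest_lowerFrameBounds (ha : 0 < a) (hb : 0 < b) (hγ : 0 < γ) (hn : 0 < n)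
    (hab : b⁻¹ = n * a) :
    IsGreatest {A : ℝ | IsLowerFrameBound (cutoffExp 2 b γ) a b A} (lowerProfile n (γ * a)) := by
  rw [← fibreConst_mul_lower ha hb hγ hn hab]
  exact ⟨isLowerFrameBound_cutoffExp_two ha hb hγ hn hab,
    fun _ hA => hA.le_fibreConst ha hb hγ hn hab⟩

theorem isLeast_upperFrameBounds (ha : 0 < a) (hb : 0 < b) (hγ : 0 < γ) (hn : 0 < n)
    (hab : b⁻¹ = n * a) :
    IsLeast {B : ℝ | IsUpperFrameBound (cutoffExp 2 b γ) a b B} (upperProfile n (γ * a)) := by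
  rw [← fibreConst_mul_upper ha hb hγ hn hab]
  exact ⟨isUpperFrameBound_cutoffExp_two ha hb hγ hn hab,
    fun _ hB => hB.fibreConst_le ha hb hγ hn hab⟩

theorem lowerBound₂_eq (ha : 0 < a) (hb : 0 < b) (hγ : 0 < γ) (hn : 0 < n)
    (hab : b⁻¹ = n * a) : lowerBound₂ a b γ = lowerProfile n (γ * a) :=
  (isGreatest_lowerFrameBounds ha hb hγ hn hab).csSup_eq

theorem upperBound₂_eq (ha : 0 < a) (hb : 0 < b) (hγ : 0 < γ) (hn : 0 < n)
    (hab : b⁻¹ = n * a) : upperBound₂ a b γ = upperProfile n (γ * a) :=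
  (isLeast_upperFrameBounds ha hb hγ hn hab).csInf_eq

end

/-! ### Hyperbolic estimates and logarithmic derivatives -/

theorem hasDerivAt_coth {x : ℝ} (hx : 0 < x) : HasDerivAt coth (1 - coth x ^ 2) x := by
  have hs : Real.sinh x ≠ 0 := (Real.sinh_pos_iff.2 hx).ne'
  have h := (Real.hasDerivAt_cosh x).div (Real.hasDerivAt_sinh x) hs
  refine h.congr_deriv ?_
  rw [coth]
  field_simp

theorem hasDerivAt_sech (x : ℝ) : HasDerivAt sech (-Real.sinh x / Real.cosh x ^ 2) x := by
  have h := (hasDerivAt_const x (1 : ℝ)).div (Real.hasDerivAt_cosh x) (Real.cosh_pos x).ne'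
  exact h.congr_deriv (by ring)

theorem one_lt_coth {x : ℝ} (hx : 0 < x) : 1 < coth x := by
  rw [coth, one_lt_div (Real.sinh_pos_iff.2 hx)]
  exact Real.sinh_lt_cosh x

theorem coth_eq_one_add {x : ℝ} (hx : 0 < x) : coth x = 1 + 2 / (Real.exp (2 * x) - 1) := by
  have h1 : 1 < Real.exp x := Real.one_lt_exp_iff.2 hx
  have h3 : Real.exp x ^ 2 - 1 ≠ 0 := by nlinarith
  have h2 : Real.exp (2 * x) = Real.exp x ^ 2 := by
    rw [← Real.exp_nat_mul]
    norm_num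
  rw [coth, Real.cosh_eq, Real.sinh_eq, h2, Real.exp_neg]
  have : Real.exp x - (Real.exp x)⁻¹ ≠ 0 := by
    intro h
    apply h3
    field_simp at h
    linarith
  field_simp
  ring

/-- The function `1 + 1/x - coth x`, the logarithmic derivative of `x (1 + coth x)`. -/
noncomputable def decayRate (x : ℝ) : ℝ := 1 + 1 / x - coth x

/-- The function `tanh (y/2) sech y`, minus the logarithmic derivative of `1 + sech y`. -/
noncomputable def sechRate (y : ℝ) : ℝ := Real.sinh y / (Real.cosh y * (Real.cosh y + 1))

theorem hasDerivAt_decayRate {x : ℝ} (hx : 0 < x) :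
    HasDerivAt decayRate (-(1 / x ^ 2) - 1 + coth x ^ 2) x := by
  have h := ((hasDerivAt_const x (1 : ℝ)).add
    ((hasDerivAt_const x (1 : ℝ)).div (hasDerivAt_id x) hx.ne')).sub (hasDerivAt_coth hx)
  refine h.congr_deriv ?_
  simp only [id]
  ring

/-- The numerator vanishes exactly when `cosh y` is the golden ratio; this is the source of the
threshold separating the two extrema. -/
theorem hasDerivAt_sechRate (y : ℝ) :
    HasDerivAt sechRate ((1 + Real.cosh y - Real.cosh y ^ 2) /
      (Real.cosh y ^ 2 * (Real.cosh y + 1))) y := by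
  have hc := Real.cosh_pos y
  have h := (Real.hasDerivAt_sinh y).div
    ((Real.hasDerivAt_cosh y).mul ((Real.hasDerivAt_cosh y).add_const 1))
    (by simp only [Pi.mul_apply]; positivity)
  refine h.congr_deriv ?_
  simp only [Pi.mul_apply]
  have h2 := Real.sinh_sq y
  field_simp
  ring_nf
  simp only [h2]
  ring

theorem coth_sq_lt {x : ℝ} (hx : 0 < x) : coth x ^ 2 < 1 + 1 / x ^ 2 := by
  have h1 : x < Real.sinh x := Real.self_lt_sinh_iff.2 hx
  have h2 : coth x ^ 2 = 1 + 1 / Real.sinh x ^ 2 := by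
    have : Real.sinh x ≠ 0 := by linarith
    rw [coth, div_pow, Real.cosh_sq]
    field_simp
  rw [h2]
  gcongr

theorem strictAntiOn_decayRate : StrictAntiOn decayRate (Set.Ioi 0) := by
  refine strictAntiOn_of_deriv_neg (convex_Ioi 0)
    (fun x hx => (hasDerivAt_decayRate hx).continuousAt.continuousWithinAt) fun x hx => ?_
  rw [interior_Ioi] at hx
  rw [(hasDerivAt_decayRate hx).deriv]
  linarith [coth_sq_lt hx]

/-- From `coth x = 1 + 2/(e^{2x} - 1)` and `e^{2x} ≥ 1 + 2x + 2x²`. -/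
theorem one_div_one_add_le_decayRate {x : ℝ} (hx : 0 < x) : 1 / (1 + x) ≤ decayRate x := by
  have h := Real.quadratic_le_exp_of_nonneg (x := 2 * x) (by linarith)
  have h2 : 2 / (Real.exp (2 * x) - 1) ≤ 2 / (2 * x * (1 + x)) := by
    gcongr
    nlinarith
  have h3 : 1 / x - 2 / (2 * x * (1 + x)) = 1 / (1 + x) := by
    field_simp
    ring
  rw [decayRate, coth_eq_one_add hx]
  linarith

theorem decayRate_pos {x : ℝ} (hx : 0 < x) : 0 < decayRate x :=
  lt_of_lt_of_le (by positivity) (one_div_one_add_le_decayRate hx)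

theorem one_div_le_coth {x : ℝ} (hx : 0 < x) : 1 / x ≤ coth x := by
  rw [coth, div_le_div_iff₀ hx (Real.sinh_pos_iff.2 hx)]
  have hd : ∀ y : ℝ, HasDerivAt (fun y => Real.cosh y * y - 1 * Real.sinh y) (y * Real.sinh y) y := by
    intro y
    refine (((Real.hasDerivAt_cosh y).mul (hasDerivAt_id y)).sub
      ((Real.hasDerivAt_sinh y).const_mul 1)).congr_deriv ?_
    simp only [id]
    ring
  have hm : MonotoneOn (fun y => Real.cosh y * y - 1 * Real.sinh y) (Set.Ici 0) := by
    refine monotoneOn_of_deriv_nonneg (convex_Ici 0)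
      (fun y _ => (hd y).continuousAt.continuousWithinAt)
      (fun y _ => (hd y).differentiableAt.differentiableWithinAt) fun y hy => ?_
    rw [interior_Ici] at hy
    rw [(hd y).deriv]
    exact mul_nonneg (le_of_lt hy) (Real.sinh_nonneg_iff.2 (le_of_lt hy))
  have := hm Set.self_mem_Ici hx.le hx.le
  simp at this
  linarith

theorem decayRate_le_one {x : ℝ} (hx : 0 < x) : decayRate x ≤ 1 := by
  rw [decayRate]
  linarith [one_div_le_coth hx]

/-- The Padé lower bound `5x / (15 + x²)` for the Langevin function `coth x - 1/x`. -/
theorem pade_le_langevin {x : ℝ} (hx : 0 < x) : 5 * x / (15 + x ^ 2) ≤ coth x - 1 / x := by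
  -- Cleared of denominators, the claim is nonnegativity of the function in `hd2`. It vanishes at 0
  -- and its derivative is `y` times the function in `hd1`, which also vanishes at 0 and has
  -- derivative `y (y cosh y - sinh y) ≥ 0`.
  have hd1 : ∀ y : ℝ, HasDerivAt
      (fun y => y ^ 2 * Real.sinh y + 3 * Real.sinh y - 3 * y * Real.cosh y)
      (y * (Real.cosh y * y - Real.sinh y)) y := by
    intro y
    refine (((((hasDerivAt_id y).pow 2).mul (Real.hasDerivAt_sinh y)).add
      ((Real.hasDerivAt_sinh y).const_mul 3)).sub
      (((hasDerivAt_id y).const_mul 3).mul (Real.hasDerivAt_cosh y))).congr_deriv ?_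
    simp
    ring
  have hd2 : ∀ y : ℝ, HasDerivAt
      (fun y => (15 * y + y ^ 3) * Real.cosh y - (15 + 6 * y ^ 2) * Real.sinh y)
      (y * (y ^ 2 * Real.sinh y + 3 * Real.sinh y - 3 * y * Real.cosh y)) y := by
    intro y
    refine (((((hasDerivAt_id y).const_mul 15).add ((hasDerivAt_id y).pow 3)).mul
      (Real.hasDerivAt_cosh y)).sub
      (((((hasDerivAt_id y).pow 2).const_mul 6).const_add 15).mul
        (Real.hasDerivAt_sinh y))).congr_deriv ?_
    simp
    ring
  have hm1 : MonotoneOn (fun y => y ^ 2 * Real.sinh y + 3 * Real.sinh y - 3 * y * Real.cosh y)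
      (Set.Ici 0) := by
    refine monotoneOn_of_deriv_nonneg (convex_Ici 0)
      (fun y _ => (hd1 y).continuousAt.continuousWithinAt)
      (fun y _ => (hd1 y).differentiableAt.differentiableWithinAt) fun y hy => ?_
    rw [interior_Ici] at hy
    rw [(hd1 y).deriv]
    have hy' : 0 < y := hy
    have := one_div_le_coth hy'
    rw [coth, div_le_div_iff₀ hy' (Real.sinh_pos_iff.2 hy')] at this
    exact mul_nonneg hy'.le (by linarith)
  have hm2 : MonotoneOn
      (fun y => (15 * y + y ^ 3) * Real.cosh y - (15 + 6 * y ^ 2) * Real.sinh y) (Set.Ici 0) := by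
    refine monotoneOn_of_deriv_nonneg (convex_Ici 0)
      (fun y _ => (hd2 y).continuousAt.continuousWithinAt)
      (fun y _ => (hd2 y).differentiableAt.differentiableWithinAt) fun y hy => ?_
    rw [interior_Ici] at hy
    rw [(hd2 y).deriv]
    have hy' : 0 < y := hy
    have := hm1 Set.self_mem_Ici hy'.le hy'.le
    simp at this
    exact mul_nonneg hy'.le (by linarith)
  have h := hm2 Set.self_mem_Ici hx.le hx.le
  simp at h
  have hs := Real.sinh_pos_iff.2 hx
  rw [coth, div_sub_div _ _ hs.ne' hx.ne', div_le_div_iff₀ (by positivity) (by positivity)]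
  nlinarith

/-- This says that `e^{x/2} * decayRate x` is nondecreasing. In terms of `w = coth x - 1/x` and `u =
1/x` the expression grows with `w` in the relevant range, so a lower bound for `w` suffices: the
Padé bound for `x ≤ 2`, and `w ≥ 1 - u` for `x ≥ 2`, where it leaves `u(1/2 - u) ≥ 0`. -/
theorem decayRate_deriv_ge {x : ℝ} (hx : 0 < x) :
    0 ≤ -(1 / x ^ 2) - 1 + coth x ^ 2 + decayRate x / 2 := by
  set w := coth x - 1 / x with hw
  set u := 1 / x with hu
  have hu0 : 0 < u := by positivity
  have e : -(1 / x ^ 2) - 1 + coth x ^ 2 + decayRate x / 2 =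
      w ^ 2 + 2 * u * w - 1 + (1 - w) / 2 := by
    rw [decayRate, ← hu, show 1 / x ^ 2 = u ^ 2 by rw [hu]; ring, show coth x = w + u by rw [hw]; ring]
    ring
  rw [e]
  rcases le_total x 2 with h2 | h2
  · have h1 := pade_le_langevin hx
    rw [← hu, ← hw] at h1
    have hu2 : 1 / 2 ≤ u := one_div_le_one_div_of_le hx h2
    set z := 5 * x / (15 + x ^ 2) with hz
    have hz0 : 0 ≤ z := by positivity
    have hz1 : 0 ≤ z ^ 2 + 2 * u * z - 1 + (1 - z) / 2 := by
      have : z ^ 2 + 2 * u * z - 1 + (1 - z) / 2 =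
          (75 - 75 * x + 40 * x ^ 2 - 5 * x ^ 3 - x ^ 4) / (2 * (15 + x ^ 2) ^ 2) := by
        rw [hz, hu]
        field_simp
        ring
      rw [this]
      apply div_nonneg _ (by positivity)
      nlinarith [mul_nonneg hx.le (sub_nonneg.2 h2), sq_nonneg (x - 1),
        mul_nonneg (mul_nonneg hx.le hx.le) (sub_nonneg.2 h2),
        mul_nonneg (mul_nonneg (mul_nonneg hx.le hx.le) hx.le) (sub_nonneg.2 h2)]
    nlinarith [mul_nonneg (sub_nonneg.2 h1) (by linarith : 0 ≤ w + z + 2 * u - 1 / 2)]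
  · have hu2 : u ≤ 1 / 2 := one_div_le_one_div_of_le two_pos h2
    have hw1 : 1 - u ≤ w := by
      have := one_lt_coth hx
      linarith
    nlinarith [mul_nonneg (sub_nonneg.2 hw1) (by linarith : 0 ≤ w + (1 - u) + 2 * u - 1 / 2)]

theorem hasDerivAt_upperProfile (n : ℕ) {x : ℝ} (hx : 0 < x) :
    HasDerivAt (upperProfile n) (n * x * (1 + coth x) * (1 + sech (n * x)) *
      (decayRate x - n * sechRate (n * x))) x := by
  have h1 : HasDerivAt (fun x : ℝ => sech (n * x))
      (-Real.sinh (n * x) / Real.cosh (n * x) ^ 2 * n) x := by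
    have := (hasDerivAt_sech (n * x)).comp x ((hasDerivAt_id x).const_mul (n : ℝ))
    simpa [Function.comp_def] using this
  have h := (((hasDerivAt_id x).const_mul (n : ℝ)).mul ((hasDerivAt_coth hx).const_add 1)).mul
    (h1.const_add 1)
  refine h.congr_deriv ?_
  have hc := Real.cosh_pos (n * x)
  simp only [Pi.mul_apply, id, decayRate, sechRate, sech]
  field_simp
  ring

theorem upperProfile_factor_pos {n : ℕ} (hn : 0 < n) {x : ℝ} (hx : 0 < x) :
    0 < n * x * (1 + coth x) * (1 + sech (n * x)) := by
  have := one_lt_coth hx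
  have h2 : 0 < sech (n * x) := div_pos one_pos (Real.cosh_pos _)
  positivity

/-- By the half-angle formulas `1 - sech y` has logarithmic derivative `coth (y/2) sech y`. -/
theorem hasDerivAt_lowerProfile {n : ℕ} (hn : 0 < n) {x : ℝ} (hx : 0 < x) :
    HasDerivAt (lowerProfile n) (n * x * (coth x - 1) * (1 - sech (n * x)) *
      (-1 + 1 / x - coth x + n * coth (x * n / 2) * sech (x * n))) x := by
  have h1 : HasDerivAt (fun x : ℝ => sech (n * x))
      (-Real.sinh (n * x) / Real.cosh (n * x) ^ 2 * n) x := by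
    have := (hasDerivAt_sech (n * x)).comp x ((hasDerivAt_id x).const_mul (n : ℝ))
    simpa [Function.comp_def] using this
  have h := (((hasDerivAt_id x).const_mul (n : ℝ)).mul ((hasDerivAt_coth hx).sub_const 1)).mul
    (h1.const_sub 1)
  refine h.congr_deriv ?_
  have hy : 0 < n * x / 2 := by positivity
  have hs := Real.sinh_pos_iff.2 hy
  have hc := Real.cosh_pos (n * x)
  have hc2 : Real.cosh (n * x) = 1 + 2 * Real.sinh (n * x / 2) ^ 2 := by
    have := Real.cosh_two_mul (n * x / 2)
    rw [mul_div_cancel₀ _ two_ne_zero] at this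
    rw [this, Real.cosh_sq]
    ring
  have hs2 : Real.sinh (n * x) = 2 * Real.sinh (n * x / 2) * Real.cosh (n * x / 2) := by
    have := Real.sinh_two_mul (n * x / 2)
    rwa [mul_div_cancel₀ _ two_ne_zero] at this
  simp only [Pi.mul_apply, id, sech, mul_comm x (n : ℝ)]
  rw [show coth (n * x / 2) = Real.cosh (n * x / 2) / Real.sinh (n * x / 2) from rfl, hs2]
  have key : (1 - 1 / Real.cosh (n * x)) * (Real.cosh (n * x / 2) / Real.sinh (n * x / 2)) =
      2 * Real.sinh (n * x / 2) * Real.cosh (n * x / 2) / Real.cosh (n * x) := by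
    rw [hc2] at hc ⊢
    field_simp
    ring
  have : n * x * (coth x - 1) * (1 - 1 / Real.cosh (n * x)) *
      (-1 + 1 / x - coth x + n * (Real.cosh (n * x / 2) / Real.sinh (n * x / 2)) *
        (1 / Real.cosh (n * x))) =
      n * x * (coth x - 1) * ((1 - 1 / Real.cosh (n * x)) * (-1 + 1 / x - coth x) +
        n * ((1 - 1 / Real.cosh (n * x)) * (Real.cosh (n * x / 2) / Real.sinh (n * x / 2))) *
        (1 / Real.cosh (n * x))) := by ring
  rw [this, key]
  field_simp
  ring

theorem lowerProfile_factor_pos {n : ℕ} (hn : 0 < n) {x : ℝ} (hx : 0 < x) :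
    0 < n * x * (coth x - 1) * (1 - sech (n * x)) := by
  have h1 : 0 < coth x - 1 := sub_pos.2 (one_lt_coth hx)
  have hy : 0 < (n : ℝ) * x := by positivity
  have h2 : 0 < 1 - sech (n * x) := by
    rw [sech, sub_pos, div_lt_one (Real.cosh_pos _)]
    exact Real.one_lt_cosh.2 hy.ne'
  positivity

theorem one_add_sq_div_two_le_cosh (y : ℝ) : 1 + y ^ 2 / 2 ≤ Real.cosh y := by
  have h : Real.cosh y = 1 + 2 * Real.sinh (y / 2) ^ 2 := by
    have := Real.cosh_two_mul (y / 2)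
    rw [mul_div_cancel₀ _ two_ne_zero] at this
    rw [this, Real.cosh_sq]
    ring
  have h2 : |y / 2| ≤ |Real.sinh (y / 2)| := by
    rcases le_total 0 (y / 2) with h0 | h0
    · rw [abs_of_nonneg h0, abs_of_nonneg (Real.sinh_nonneg_iff.2 h0)]
      exact Real.self_le_sinh_iff.2 h0
    · rw [abs_of_nonpos h0, abs_of_nonpos (Real.sinh_nonpos_iff.2 h0)]
      exact neg_le_neg (Real.sinh_le_self_iff.2 h0)
  have := sq_le_sq.2 h2
  rw [h]
  linarith

theorem cosh_one_lt : Real.cosh 1 < 1.545 := by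
  have h1 := Real.exp_one_lt_d9
  have h2 := Real.exp_one_gt_d9
  rw [Real.cosh_eq, Real.exp_neg]
  have h3 : (Real.exp 1)⁻¹ < 0.3679 := by
    rw [inv_lt_comm₀ (by positivity) (by norm_num)]
    norm_num
    linarith
  linarith

/-! ### The unique maximum of the lower bound -/

theorem sech_pos (x : ℝ) : 0 < sech x := div_pos one_pos (Real.cosh_pos _)

theorem sech_strictAntiOn : StrictAntiOn sech (Set.Ioi 0) := fun _ hx _ hy hxy =>
  one_div_lt_one_div_of_lt (Real.cosh_pos _) (Real.cosh_strictMonoOn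
    (le_of_lt (Set.mem_Ioi.1 hx)) (le_of_lt (Set.mem_Ioi.1 hy)) hxy)

theorem coth_antitoneOn : AntitoneOn coth (Set.Ioi 0) := by
  refine antitoneOn_of_deriv_nonpos (convex_Ioi 0)
    (fun x hx => (hasDerivAt_coth hx).continuousAt.continuousWithinAt)
    (fun x hx => ?_) fun x hx => ?_
  · rw [interior_Ioi] at hx
    exact (hasDerivAt_coth hx).differentiableAt.differentiableWithinAt
  · rw [interior_Ioi] at hx
    rw [(hasDerivAt_coth hx).deriv]
    nlinarith [one_lt_coth hx]

/-- The logarithmic derivative of `lowerProfile n`. -/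
noncomputable def lowerRate (n : ℕ) (x : ℝ) : ℝ :=
  -1 + 1 / x - coth x + n * coth (x * n / 2) * sech (x * n)

theorem lowerRate_eq (n : ℕ) (x : ℝ) :
    lowerRate n x = decayRate x - 2 + n * coth (x * n / 2) * sech (x * n) := by
  rw [lowerRate, decayRate]
  ring

/-- A strictly decreasing `decayRate` plus a product of positive decreasing factors. -/
theorem strictAntiOn_lowerRate {n : ℕ} (hn : 0 < n) : StrictAntiOn (lowerRate n) (Set.Ioi 0) := by
  intro x hx y hy hxy
  have hx0 : 0 < x := hx
  have hy0 : 0 < y := hy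
  rw [lowerRate_eq, lowerRate_eq]
  have h1 := strictAntiOn_decayRate hx hy hxy
  have h2 : coth (y * n / 2) ≤ coth (x * n / 2) := by
    refine coth_antitoneOn (Set.mem_Ioi.2 (by positivity)) (Set.mem_Ioi.2 (by positivity)) ?_
    gcongr
  have h3 : sech (y * n) ≤ sech (x * n) := by
    refine sech_strictAntiOn.antitoneOn (Set.mem_Ioi.2 (by positivity))
      (Set.mem_Ioi.2 (by positivity)) ?_
    gcongr
  have h4 : 0 < coth (x * n / 2) := lt_trans one_pos (one_lt_coth (by positivity))
  have h5 := sech_pos (y * n)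
  have : (n : ℝ) * coth (y * n / 2) * sech (y * n) ≤ n * coth (x * n / 2) * sech (x * n) := by
    gcongr
  linarith

theorem exists_lowerRate_zero {n : ℕ} (hn : 0 < n) : ∃ x₀ : ℝ, 0 < x₀ ∧ lowerRate n x₀ = 0 := by
  have hn1 : (1 : ℝ) ≤ n := by exact_mod_cast hn
  have hn0 : (0 : ℝ) < n := by linarith
  -- At `1/(2n)` the arguments become `1/4` and `1/2` for every `n`, and the last term is at least
  -- `4 * (1/2) = 2`, which offsets the `-2` in `lowerRate_eq`.
  have hx1 : (0 : ℝ) < 1 / (2 * n) := by positivity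
  have hle : 1 / (2 * (n : ℝ)) ≤ 4 := by
    rw [div_le_iff₀ (by positivity)]
    linarith
  have hpos : 0 ≤ lowerRate n (1 / (2 * n)) := by
    have e1 : 1 / (2 * (n : ℝ)) * n / 2 = 1 / 4 := by field_simp; norm_num
    have e2 : 1 / (2 * (n : ℝ)) * n = 1 / 2 := by field_simp
    rw [lowerRate_eq, e1, e2]
    have h1 := decayRate_pos hx1
    have h2 : (4 : ℝ) ≤ coth (1 / 4) := by
      have := one_div_le_coth (x := 1 / 4) (by norm_num)
      norm_num at this ⊢
      exact this
    have h3 : 1 / 2 ≤ sech (1 / 2) := by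
      refine one_div_le_one_div_of_le (Real.cosh_pos _) ?_
      have : Real.cosh (1 / 2) ≤ Real.cosh 1 := by
        rw [Real.cosh_le_cosh, abs_of_pos (by norm_num), abs_one]
        norm_num
      linarith [cosh_one_lt]
    have h4 : (1 : ℝ) * 4 * (1 / 2) ≤ n * coth (1 / 4) * sech (1 / 2) := by
      gcongr
    linarith
  -- At 4 the rate is at most `1/4 - 2 + 3/16`, uniformly in `n`.
  have hneg : lowerRate n 4 ≤ 0 := by
    rw [lowerRate_eq]
    have h1 : decayRate 4 ≤ 1 / 4 := by
      rw [decayRate]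
      linarith [one_lt_coth (x := 4) (by norm_num)]
    have h2 : coth (4 * n / 2) ≤ 3 / 2 := by
      have h := decayRate_pos (x := 4 * n / 2) (by positivity)
      rw [decayRate] at h
      have : 1 / (4 * (n : ℝ) / 2) ≤ 1 / 2 := one_div_le_one_div_of_le two_pos (by linarith)
      linarith
    have h3 : sech (4 * n) ≤ 1 / (8 * n) := by
      refine one_div_le_one_div_of_le (by positivity) ?_
      have := one_add_sq_div_two_le_cosh (4 * n)
      nlinarith
    have h0 : 0 < coth (4 * n / 2) := lt_trans one_pos (one_lt_coth (by positivity))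
    have h4 : (n : ℝ) * coth (4 * n / 2) * sech (4 * n) ≤ n * (3 / 2) * (1 / (8 * n)) := by
      have := sech_pos (4 * n)
      gcongr
    have h5 : (n : ℝ) * (3 / 2) * (1 / (8 * n)) = 3 / 16 := by field_simp; norm_num
    linarith
  have hc : ContinuousOn (lowerRate n) (Set.Icc (1 / (2 * (n : ℝ))) 4) := by
    intro x hx
    have hx0 : 0 < x := lt_of_lt_of_le hx1 hx.1
    have c1 : ContinuousAt (fun x : ℝ => coth (x * n / 2)) x :=
      ContinuousAt.comp (f := fun x : ℝ => x * n / 2) (g := coth)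
        (hasDerivAt_coth (by positivity)).continuousAt (by fun_prop)
    have c2 : ContinuousAt (fun x : ℝ => sech (x * n)) x :=
      ContinuousAt.comp (f := fun x : ℝ => x * n) (g := sech)
        (hasDerivAt_sech _).continuousAt (by fun_prop)
    have c3 := (hasDerivAt_decayRate hx0).continuousAt
    have : lowerRate n = fun x => decayRate x - 2 + n * coth (x * n / 2) * sech (x * n) :=
      funext (lowerRate_eq n)
    rw [this]
    exact ((c3.sub continuousAt_const).add
      ((continuousAt_const.mul c1).mul c2)).continuousWithinAt
  obtain ⟨x₀, h1, h2⟩ := intermediate_value_Icc' hle hc ⟨hneg, hpos⟩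
  exact ⟨x₀, lt_of_lt_of_le hx1 h1.1, h2⟩

/-! ### Sign of the logarithmic derivative of the upper bound -/

/-- The logarithmic derivative of `upperProfile n`. -/
noncomputable def upperRate (n : ℕ) (x : ℝ) : ℝ := decayRate x - n * sechRate (n * x)

theorem hasDerivAt_upperRate (n : ℕ) {x : ℝ} (hx : 0 < x) :
    HasDerivAt (upperRate n) (-(1 / x ^ 2) - 1 + coth x ^ 2 -
      n * ((1 + Real.cosh (n * x) - Real.cosh (n * x) ^ 2) /
      (Real.cosh (n * x) ^ 2 * (Real.cosh (n * x) + 1)) * n)) x := by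
  have h1 := (hasDerivAt_sechRate (n * x)).comp x ((hasDerivAt_id x).const_mul (n : ℝ))
  rw [mul_one] at h1
  exact (hasDerivAt_decayRate hx).sub (h1.const_mul (n : ℝ))

theorem upperRate_one_pos {x : ℝ} (hx : 0 < x) : 0 < upperRate 1 x := by
  have h1 := one_div_one_add_le_decayRate hx
  have h2 : sechRate x < 1 / (1 + x) := by
    have hc := Real.cosh_pos x
    have hs := Real.sinh_lt_cosh x
    have hx' : x < Real.sinh x := Real.self_lt_sinh_iff.2 hx
    rw [sechRate, div_lt_div_iff₀ (by positivity) (by positivity)]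
    nlinarith
  rw [upperRate, Nat.cast_one, one_mul, one_mul]
  linarith

theorem upperRate_two_pos {x : ℝ} (hx : 0 < x) : 0 < upperRate 2 x := by
  have h1 := one_div_one_add_le_decayRate hx
  have h2 : 2 * sechRate (2 * x) < 1 / (1 + x) := by
    have hc := Real.cosh_pos (2 * x)
    rw [sechRate, ← mul_div_assoc, div_lt_div_iff₀ (by positivity) (by positivity)]
    set E := Real.exp (2 * x) with hE
    have hE1 : 1 < E := Real.one_lt_exp_iff.2 (by linarith)
    -- The tangent bound `2x ≤ E / e` replaces `x` by a multiple of `E`, and what remains is a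
    -- quadratic in `E` with negative discriminant.
    have hy : 2 * x ≤ E * 0.368 := by
      have h3 := Real.add_one_le_exp (2 * x - 1)
      rw [Real.exp_sub, ← hE] at h3
      have h4 : E / Real.exp 1 ≤ E * 0.368 := by
        rw [div_le_iff₀ (Real.exp_pos 1)]
        have := Real.exp_one_gt_d9
        nlinarith
      linarith
    have hE0 : 0 < E := by linarith
    have hs : Real.sinh (2 * x) = (E ^ 2 - 1) / (2 * E) := by
      rw [Real.sinh_eq, Real.exp_neg, ← hE]
      field_simp
    have hc' : Real.cosh (2 * x) = (E ^ 2 + 1) / (2 * E) := by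
      rw [Real.cosh_eq, Real.exp_neg, ← hE]
      field_simp
    rw [hs, hc']
    have hs0 : 0 < (E ^ 2 - 1) / (2 * E) := div_pos (by nlinarith) (by positivity)
    have step : 2 * ((E ^ 2 - 1) / (2 * E)) * (1 + x) ≤
        (E ^ 2 - 1) / (2 * E) * (2 + E * 0.368) := by
      have : 2 * ((E ^ 2 - 1) / (2 * E)) * (1 + x) = (E ^ 2 - 1) / (2 * E) * (2 + 2 * x) := by ring
      rw [this]
      gcongr
    refine step.trans_lt ?_
    rw [one_mul, ← sub_pos]
    have : (E ^ 2 + 1) / (2 * E) * ((E ^ 2 + 1) / (2 * E) + 1) -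
        (E ^ 2 - 1) / (2 * E) * (2 + E * 0.368) =
        (E + 1) * (E * (0.264 * E ^ 2 - 2.264 * E + 5) + 1) / (4 * E ^ 2) := by
      field_simp
      ring
    rw [this]
    have hq : 0 < 0.264 * E ^ 2 - 2.264 * E + 5 := by nlinarith [sq_nonneg (E - 4.288)]
    positivity
  rw [upperRate, Nat.cast_two]
  linarith

theorem sechRate_sq {y : ℝ} :
    sechRate y ^ 2 = (Real.cosh y - 1) / (Real.cosh y ^ 2 * (Real.cosh y + 1)) := by
  have hc := Real.cosh_pos y
  rw [sechRate, div_pow, Real.sinh_sq]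
  field_simp
  ring

/-- The square is rational in `cosh y`. The constant is chosen so that `3 * 0.2958 > 0.8844` and `4
* 0.2958 > 1`. -/
theorem sechRate_lower {y : ℝ} (hy : 0 < y) (h1 : 1.6 ≤ Real.cosh y) (h2 : Real.cosh y ≤ 1.81) :
    0.2958 < sechRate y := by
  have hs : 0 < sechRate y := by
    have := Real.cosh_pos y
    have := Real.sinh_pos_iff.2 hy
    rw [sechRate]
    positivity
  refine lt_of_pow_lt_pow_left₀ 2 hs.le ?_
  rw [sechRate_sq, lt_div_iff₀ (by positivity)]
  set c := Real.cosh y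
  nlinarith [mul_nonneg (sub_nonneg.2 h1) (sub_nonneg.2 h2),
    mul_nonneg (mul_nonneg (sub_nonneg.2 h1) (sub_nonneg.2 h2)) (by linarith : 0 ≤ c)]

theorem cosh_1_05_lt : Real.cosh 1.05 < 1.607 := by
  have h1 := Real.exp_one_lt_d9
  have h2 := Real.exp_one_gt_d9
  have h3 : Real.exp 0.05 ≤ 1 / (1 - 0.05) := by
    have := Real.add_one_le_exp (-0.05 : ℝ)
    have h := mul_le_mul_of_nonneg_left this (Real.exp_nonneg 0.05)
    rw [Real.exp_neg, mul_inv_cancel₀ (Real.exp_pos 0.05).ne'] at h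
    rw [le_div_iff₀ (by norm_num)]
    linarith
  have h4 : 1.05 ≤ Real.exp 0.05 := by
    have := Real.add_one_le_exp (0.05 : ℝ)
    linarith
  have e : Real.exp 1.05 = Real.exp 1 * Real.exp 0.05 := by
    rw [← Real.exp_add]
    norm_num
  have h5 : Real.exp 1.05 < 2.8615 := by
    rw [e]
    calc _ ≤ Real.exp 1 * (1 / (1 - 0.05)) := by gcongr
      _ < _ := by
        norm_num
        linarith
  have h6 : 2.854 < Real.exp 1.05 := by
    rw [e]
    nlinarith
  have h7 : (Real.exp 1.05)⁻¹ < 0.351 := by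
    rw [inv_lt_comm₀ (by positivity) (by norm_num)]
    refine lt_trans ?_ h6
    norm_num
  rw [Real.cosh_eq, Real.exp_neg]
  linarith

theorem golden_bounds : 1.618 < (1 + Real.sqrt 5) / 2 ∧ (1 + Real.sqrt 5) / 2 < 1.619 := by
  have h1 : 2.236 < Real.sqrt 5 := Real.lt_sqrt_of_sq_lt (by norm_num)
  have h2 : Real.sqrt 5 < 2.238 := by
    rw [Real.sqrt_lt' (by norm_num)]
    norm_num
  constructor <;> linarith

theorem golden_sq : ((1 + Real.sqrt 5) / 2) ^ 2 = (1 + Real.sqrt 5) / 2 + 1 := by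
  have := Real.sq_sqrt (show (0 : ℝ) ≤ 5 by norm_num)
  nlinarith

section

variable {n : ℕ} {x : ℝ}

/-- For `n ≥ 4` the bound `decayRate ≤ 1` suffices. For `n = 3` it does not: `cosh 3x ≥ 1.618 > cosh
1.05` forces `x ≥ 0.35`, where the Padé bound gives `decayRate ≤ 0.8844`. -/
theorem upperRate_neg_of_cosh_mem (hn : 3 ≤ n) (hx : 0 < x) (h1 : 1.618 ≤ Real.cosh (n * x))
    (h2 : Real.cosh (n * x) ≤ 1.81) : upperRate n x < 0 := by
  have hn0 : (0 : ℝ) < n := by positivity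
  have hs := sechRate_lower (y := n * x) (by positivity) (by linarith) h2
  rw [upperRate]
  rcases hn.eq_or_lt with rfl | hn4
  · have hx2 : 0.35 ≤ x := by
      by_contra! h
      have : Real.cosh ((3 : ℕ) * x) ≤ Real.cosh 1.05 := by
        rw [Real.cosh_le_cosh, abs_of_pos (by positivity), abs_of_pos (by norm_num)]
        push_cast
        linarith
      linarith [cosh_1_05_lt]
    have h3 : decayRate x ≤ decayRate 0.35 :=
      strictAntiOn_decayRate.antitoneOn (Set.mem_Ioi.2 (by norm_num)) hx hx2
    have h4 := pade_le_langevin (x := 0.35) (by norm_num)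
    have h5 : decayRate 0.35 ≤ 0.8844 := by
      rw [decayRate]
      norm_num at h4 ⊢
      linarith
    push_cast at hs ⊢
    linarith
  · have h3 := decayRate_le_one hx
    have h4 : (4 : ℝ) ≤ n := by exact_mod_cast hn4
    nlinarith

/-- Below the golden ratio `sechRate` is still increasing, so a nondecreasing term is subtracted
from a strictly decreasing one. -/
theorem upperRate_strictAntiOn {y : ℝ} (hn : 0 < n) (hcy : Real.cosh (n * y) ^ 2 ≤ 1 + Real.cosh (n * y)) :
    StrictAntiOn (upperRate n) (Set.Ioc 0 y) := by
  refine strictAntiOn_of_deriv_neg (convex_Ioc 0 y)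
    (fun x hx => (hasDerivAt_upperRate n hx.1).continuousAt.continuousWithinAt) fun x hx => ?_
  rw [interior_Ioc] at hx
  have hx0 : 0 < x := hx.1
  rw [(hasDerivAt_upperRate n hx0).deriv]
  have h1 := coth_sq_lt hx0
  have h2 : Real.cosh (n * x) ≤ Real.cosh (n * y) := by
    rw [Real.cosh_le_cosh, abs_of_pos (by positivity),
      abs_of_pos (by have := hx0.trans hx.2; positivity)]
    have := hx.2
    gcongr
  have h3 := Real.one_le_cosh (n * x)
  have h4 : 0 ≤ 1 + Real.cosh (n * x) - Real.cosh (n * x) ^ 2 := by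
    nlinarith [mul_nonneg (sub_nonneg.2 h2)
      (by linarith : 0 ≤ Real.cosh (n * x) + Real.cosh (n * y) - 1)]
  have h5 : 0 ≤ n * ((1 + Real.cosh (n * x) - Real.cosh (n * x) ^ 2) /
      (Real.cosh (n * x) ^ 2 * (Real.cosh (n * x) + 1)) * n) := by positivity
  linarith

/-- The rate itself is not monotone here: it ends up positive and decays to 0 like `1/x`. The factor
`e^{x/2}` preserves signs, makes the `decayRate` part nondecreasing and makes the negative
`sechRate` part increase strictly. -/
theorem exp_mul_upperRate_strictMonoOn {y : ℝ} (hn : 3 ≤ n) (hy : 0 < y)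
    (hcy : 1.81 ≤ Real.cosh (n * y)) :
    StrictMonoOn (fun x => Real.exp (x / 2) * upperRate n x) (Set.Ici y) := by
  have hn3 : (3 : ℝ) ≤ n := by exact_mod_cast hn
  have hd : ∀ x, 0 < x → HasDerivAt (fun x => Real.exp (x / 2) * upperRate n x)
      (Real.exp (x / 2) * (1 / 2) * upperRate n x + Real.exp (x / 2) *
      (-(1 / x ^ 2) - 1 + coth x ^ 2 -
      n * ((1 + Real.cosh (n * x) - Real.cosh (n * x) ^ 2) /
      (Real.cosh (n * x) ^ 2 * (Real.cosh (n * x) + 1)) * n))) x := fun x hx =>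
    (((hasDerivAt_id x).div_const 2).exp).mul (hasDerivAt_upperRate n hx)
  refine strictMonoOn_of_deriv_pos (convex_Ici y)
    (fun x hx => (hd x (hy.trans_le hx)).continuousAt.continuousWithinAt) fun x hx => ?_
  rw [interior_Ici] at hx
  have hx0 : 0 < x := hy.trans hx
  rw [(hd x hx0).deriv]
  have h1 := decayRate_deriv_ge hx0
  have h2 : Real.cosh (n * y) ≤ Real.cosh (n * x) := by
    rw [Real.cosh_le_cosh, abs_of_pos (by positivity), abs_of_pos (by positivity)]
    have : y ≤ x := le_of_lt hx
    gcongr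
  set c := Real.cosh (n * x) with hc
  have hc1 : 1.81 ≤ c := hcy.trans h2
  have hsq := Real.sinh_sq (n * x)
  have hs0 : 0 < Real.sinh (n * x) := Real.sinh_pos_iff.2 (by positivity)
  -- The factor 6 is `2 * 3 ≤ 2n`. The value 1.81 lies just past the point where this inequality
  -- starts to hold; squaring and writing `c = 1.81 + d` leaves a polynomial with positive
  -- coefficients.
  have h3 : c * Real.sinh (n * x) < 6 * (c ^ 2 - c - 1) := by
    refine lt_of_pow_lt_pow_left₀ 2 (by nlinarith) ?_
    rw [mul_pow, hsq, ← hc]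
    obtain ⟨d, hd⟩ : ∃ d, c = 1.81 + d := ⟨c - 1.81, by ring⟩
    have hd0 : 0 ≤ d := by linarith
    rw [← sub_pos, hd]
    ring_nf
    positivity
  have h4 : 0 < -(sechRate (n * x) / 2) - n * ((1 + c - c ^ 2) / (c ^ 2 * (c + 1))) := by
    have e : -(sechRate (n * x) / 2) - n * ((1 + c - c ^ 2) / (c ^ 2 * (c + 1))) =
        (2 * n * (c ^ 2 - c - 1) - c * Real.sinh (n * x)) / (2 * (c ^ 2 * (c + 1))) := by
      rw [sechRate, ← hc]
      field_simp
      ring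
    rw [e]
    refine div_pos ?_ (by positivity)
    have : 0 < c ^ 2 - c - 1 := by nlinarith
    nlinarith
  have h5 : 0 < n * (-(sechRate (n * x) / 2) - n * ((1 + c - c ^ 2) / (c ^ 2 * (c + 1)))) := by
    positivity
  have e : Real.exp (x / 2) * (1 / 2) * upperRate n x + Real.exp (x / 2) *
      (-(1 / x ^ 2) - 1 + coth x ^ 2 - n * ((1 + c - c ^ 2) / (c ^ 2 * (c + 1)) * n)) =
      Real.exp (x / 2) * ((-(1 / x ^ 2) - 1 + coth x ^ 2 + decayRate x / 2) +
        n * (-(sechRate (n * x) / 2) - n * ((1 + c - c ^ 2) / (c ^ 2 * (c + 1))))) := by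
    rw [upperRate]
    ring
  rw [e]
  have := Real.exp_pos (x / 2)
  positivity

/-- With `cosh nz` the golden ratio and `cosh nm = 1.81`, the rate decreases on `(0, z]`, is
negative on `[z, m]`, and has at most one zero beyond `m`. Points of nonnegative rate on both outer
pieces give one zero on each. -/
theorem exists_upperRate_sign (hn : 3 ≤ n) : ∃ x₁ x₂ : ℝ, 0 < x₁ ∧
    x₁ < Real.arcosh ((1 + Real.sqrt 5) / 2) / n ∧
    Real.arcosh ((1 + Real.sqrt 5) / 2) / n < x₂ ∧
    (∀ x, 0 < x → x < x₁ → 0 < upperRate n x) ∧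
    (∀ x, x₁ < x → x < x₂ → upperRate n x < 0) ∧
    (∀ x, x₂ < x → 0 < upperRate n x) := by
  have hn3 : (3 : ℝ) ≤ n := by exact_mod_cast hn
  have hn0 : (0 : ℝ) < n := by linarith
  obtain ⟨hg1, hg2⟩ := golden_bounds
  set φ := (1 + Real.sqrt 5) / 2 with hφ
  set z := Real.arcosh φ / n with hz
  set m := Real.arcosh 1.81 / n with hm
  have hz0 : 0 < z := div_pos (Real.arcosh_pos (by linarith)) hn0
  have hzm : z < m := by
    refine div_lt_div_of_pos_right ?_ hn0
    rw [Real.arcosh_lt_arcosh (by linarith) (by norm_num)]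
    linarith
  have hm0 := hz0.trans hzm
  have hcz : Real.cosh (n * z) = φ := by
    rw [hz, mul_div_cancel₀ _ hn0.ne', Real.cosh_arcosh (by linarith)]
  have hcm : Real.cosh (n * m) = 1.81 := by
    rw [hm, mul_div_cancel₀ _ hn0.ne', Real.cosh_arcosh (by norm_num)]
  have hmono : ∀ {x y : ℝ}, 0 < x → x ≤ y → Real.cosh (n * x) ≤ Real.cosh (n * y) := by
    intro x y h1 h2
    have h3 := h1.trans_le h2
    rw [Real.cosh_le_cosh, abs_of_pos (by positivity), abs_of_pos (by positivity)]
    gcongr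
  have hmid : ∀ x, z ≤ x → x ≤ m → upperRate n x < 0 := by
    intro x h1 h2
    have hx0 := hz0.trans_le h1
    refine upperRate_neg_of_cosh_mem hn hx0 ?_ ?_
    · have := hmono hz0 h1
      linarith
    · have := hmono hx0 h2
      linarith
  have hanti := upperRate_strictAntiOn (n := n) (y := z) (by omega)
    (by rw [hcz, hφ, golden_sq]; linarith)
  have hmonoE := exp_mul_upperRate_strictMonoOn hn hm0 hcm.ge
  have hcont : ∀ u v : ℝ, 0 < u → ContinuousOn (upperRate n) (Set.Icc u v) := fun u v hu x hx =>
    (hasDerivAt_upperRate n (hu.trans_le hx.1)).continuousAt.continuousWithinAt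
  -- a point with positive rate to the left of `z`
  obtain ⟨l, hl0, hlz, hlpos⟩ : ∃ l, 0 < l ∧ l < z ∧ 0 ≤ upperRate n l := by
    -- Chosen so that `n * sinh (n * l) = 1`: then `n * sechRate (n * l) ≤ 1/2`, while `l ≤ 1` gives
    -- `decayRate l ≥ 1/2`.
    refine ⟨Real.arsinh (1 / n) / n, by
      have := Real.arsinh_pos_iff.2 (show (0 : ℝ) < 1 / n by positivity)
      positivity, ?_, ?_⟩
    · refine div_lt_div_of_pos_right ?_ hn0
      rw [← abs_of_pos (Real.arsinh_pos_iff.2 (show (0 : ℝ) < 1 / n by positivity)),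
        ← abs_of_pos (Real.arcosh_pos (show 1 < φ by linarith)), ← Real.cosh_lt_cosh,
        Real.cosh_arsinh, Real.cosh_arcosh (by linarith), Real.sqrt_lt' (by linarith)]
      have : 1 / (n : ℝ) ≤ 1 / 3 := one_div_le_one_div_of_le (by norm_num) hn3
      have h0 : 0 < 1 / (n : ℝ) := by positivity
      nlinarith
    · have hy0 := Real.arsinh_pos_iff.2 (show (0 : ℝ) < 1 / n by positivity)
      have hy1 : Real.arsinh (1 / n) ≤ 1 / n := by
        have := Real.self_le_sinh_iff.2 hy0.le
        rwa [Real.sinh_arsinh] at this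
      have hle : Real.arsinh (1 / n) / n ≤ 1 := by
        rw [div_le_one hn0]
        refine hy1.trans ?_
        rw [div_le_iff₀ hn0]
        nlinarith
      have h1 := one_div_one_add_le_decayRate
        (x := Real.arsinh (1 / n) / n) (by positivity)
      have h2 : 1 / 2 ≤ 1 / (1 + Real.arsinh (1 / n) / n) :=
        one_div_le_one_div_of_le (by positivity) (by linarith)
      rw [upperRate, mul_div_cancel₀ _ hn0.ne', sechRate, Real.sinh_arsinh]
      have h3 : n * (1 / (n : ℝ) / (Real.cosh (Real.arsinh (1 / n)) *
          (Real.cosh (Real.arsinh (1 / n)) + 1))) ≤ 1 / 2 := by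
        rw [← mul_div_assoc, mul_one_div_cancel hn0.ne']
        have := Real.one_le_cosh (Real.arsinh (1 / n))
        exact one_div_le_one_div_of_le two_pos (by nlinarith)
      linarith
  -- a point with positive rate to the right of `m`
  have hm2 : m < 2 := by
    by_contra! h
    have := hmono two_pos h
    have h2 := one_add_sq_div_two_le_cosh (n * 2)
    nlinarith
  have h2pos : 0 ≤ upperRate n 2 := by
    have h1 := one_div_one_add_le_decayRate (x := 2) two_pos
    have hc := Real.cosh_pos (n * 2)
    have h2 : sechRate (n * 2) ≤ 1 / (2 * n ^ 2) := by
      rw [sechRate, div_le_div_iff₀ (by positivity) (by positivity)]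
      have h3 := Real.sinh_lt_cosh (n * 2)
      have h4 := one_add_sq_div_two_le_cosh (n * 2)
      have hs := Real.sinh_pos_iff.2 (show 0 < (n : ℝ) * 2 by positivity)
      calc Real.sinh (n * 2) * (2 * n ^ 2) ≤ Real.cosh (n * 2) * (Real.cosh (n * 2) + 1) := by
            gcongr
            nlinarith
        _ = _ := by ring
    have h3 : n * sechRate (n * 2) ≤ n * (1 / (2 * n ^ 2)) := by gcongr
    have h4 : n * (1 / (2 * (n : ℝ) ^ 2)) = 1 / (2 * n) := by field_simp
    have h5 : 1 / (2 * (n : ℝ)) ≤ 1 / (1 + 2) :=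
      one_div_le_one_div_of_le (by norm_num) (by linarith)
    rw [upperRate]
    linarith
  obtain ⟨x₁, hx₁, hx₁0⟩ := intermediate_value_Icc' hlz.le (hcont l z hl0)
    ⟨(hmid z le_rfl hzm.le).le, hlpos⟩
  obtain ⟨x₂, hx₂, hx₂0⟩ := intermediate_value_Icc hm2.le (hcont m 2 hm0)
    ⟨(hmid m hzm.le le_rfl).le, h2pos⟩
  have hx1pos := hl0.trans_le hx₁.1
  have hx1z : x₁ < z := lt_of_le_of_ne hx₁.2 fun h => by
    have := hmid z le_rfl hzm.le
    rw [← h, hx₁0] at this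
    exact lt_irrefl _ this
  have hx2m : m < x₂ := lt_of_le_of_ne hx₂.1 fun h => by
    have := hmid m hzm.le le_rfl
    rw [h, hx₂0] at this
    exact lt_irrefl _ this
  refine ⟨x₁, x₂, hx1pos, hx1z, hzm.trans hx2m, ?_, ?_, ?_⟩
  · intro x h0 h1
    have := hanti ⟨h0, (h1.trans hx1z).le⟩ ⟨hx1pos, hx1z.le⟩ h1
    rwa [hx₁0] at this
  · intro x h1 h2
    rcases le_total x z with h3 | h3
    · have := hanti ⟨hx1pos, hx1z.le⟩ ⟨hx1pos.trans h1, h3⟩ h1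
      rwa [hx₁0] at this
    · rcases le_total x m with h4 | h4
      · exact hmid x h3 h4
      · have := hmonoE (Set.mem_Ici.2 h4) (Set.mem_Ici.2 hx2m.le) h2
        simp only [hx₂0, mul_zero] at this
        exact (pos_iff_neg_of_mul_neg this).1 (Real.exp_pos _)
  · intro x h1
    have := hmonoE (Set.mem_Ici.2 hx2m.le) (Set.mem_Ici.2 (hx2m.trans h1).le) h1
    simp only [hx₂0, mul_zero] at this
    exact (pos_iff_pos_of_mul_pos this).1 (Real.exp_pos _)

end

/-! ### From derivative signs to extrema, and the limit at `0⁺` -/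

section

open Filter Topology

variable {F F' : ℝ → ℝ}

theorem strictMonoOn_of_hasDerivAt_pos {s : Set ℝ} (hs : Convex ℝ s) (hs0 : s ⊆ Set.Ioi 0)
    (hF : ∀ x, 0 < x → HasDerivAt F (F' x) x) (hpos : ∀ x ∈ interior s, 0 < F' x) :
    StrictMonoOn F s :=
  strictMonoOn_of_deriv_pos hs (fun x hx => (hF x (hs0 hx)).continuousAt.continuousWithinAt)
    fun x hx => by
      rw [(hF x (hs0 (interior_subset hx))).deriv]
      exact hpos x hx

theorem strictAntiOn_of_hasDerivAt_neg {s : Set ℝ} (hs : Convex ℝ s) (hs0 : s ⊆ Set.Ioi 0)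
    (hF : ∀ x, 0 < x → HasDerivAt F (F' x) x) (hneg : ∀ x ∈ interior s, F' x < 0) :
    StrictAntiOn F s :=
  strictAntiOn_of_deriv_neg hs (fun x hx => (hF x (hs0 hx)).continuousAt.continuousWithinAt)
    fun x hx => by
      rw [(hF x (hs0 (interior_subset hx))).deriv]
      exact hneg x hx

theorem lt_of_deriv_sign {x₀ : ℝ} (hx₀ : 0 < x₀) (hF : ∀ x, 0 < x → HasDerivAt F (F' x) x)
    (hpos : ∀ x, 0 < x → x < x₀ → 0 < F' x) (hneg : ∀ x, x₀ < x → F' x < 0)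
    {x : ℝ} (hx : 0 < x) (hne : x ≠ x₀) : F x < F x₀ := by
  rcases hne.lt_or_gt with h | h
  · refine strictMonoOn_of_hasDerivAt_pos (convex_Ioc 0 x₀) (fun y hy => hy.1) hF
      (fun y hy => ?_) ⟨hx, h.le⟩ ⟨hx₀, le_rfl⟩ h
    rw [interior_Ioc] at hy
    exact hpos y hy.1 hy.2
  · refine strictAntiOn_of_hasDerivAt_neg (convex_Ici x₀) (fun y hy => hx₀.trans_le hy) hF
      (fun y hy => ?_) Set.self_mem_Ici h.le h
    rw [interior_Ici] at hy
    exact hneg y hy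

variable {x₁ x₂ : ℝ}

/-- A vanishing derivative leaves only `x₁` and `x₂`, where no sign is assumed; strict decrease on
`[x₁, x₂]` excludes `x₂`. -/
theorem isLocalMax_iff_of_deriv_sign (hx₁ : 0 < x₁) (h12 : x₁ < x₂)
    (hF : ∀ x, 0 < x → HasDerivAt F (F' x) x) (h1 : ∀ x, 0 < x → x < x₁ → 0 < F' x)
    (h2 : ∀ x, x₁ < x → x < x₂ → F' x < 0) (h3 : ∀ x, x₂ < x → 0 < F' x) {x : ℝ} (hx : 0 < x) :
    IsLocalMax F x ↔ x = x₁ := by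
  have hanti : StrictAntiOn F (Set.Icc x₁ x₂) := by
    refine strictAntiOn_of_hasDerivAt_neg (convex_Icc _ _) (fun y hy => hx₁.trans_le hy.1) hF ?_
    intro y hy
    rw [interior_Icc] at hy
    exact h2 y hy.1 hy.2
  constructor
  · intro h
    have h0 := h.hasDerivAt_eq_zero (hF x hx)
    rcases lt_trichotomy x x₁ with hlt | heq | hgt
    · exact absurd h0 (h1 x hx hlt).ne'
    · exact heq
    · rcases lt_trichotomy x x₂ with hlt2 | heq2 | hgt2
      · exact absurd h0 (h2 x hgt hlt2).ne
      · subst heq2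
        have hev : ∀ᶠ y in 𝓝[<] x, F y ≤ F x ∧ y ∈ Set.Ioo x₁ x :=
          (h.filter_mono nhdsWithin_le_nhds).and (Ioo_mem_nhdsLT h12)
        obtain ⟨y, hy1, hy2⟩ := hev.exists
        have := hanti ⟨hy2.1.le, hy2.2.le⟩ ⟨h12.le, le_rfl⟩ hy2.2
        linarith
      · exact absurd h0 (h3 x hgt2).ne'
  · rintro rfl
    have hmono : StrictMonoOn F (Set.Ioc 0 x) := by
      refine strictMonoOn_of_hasDerivAt_pos (convex_Ioc _ _) (fun y hy => hy.1) hF ?_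
      intro y hy
      rw [interior_Ioc] at hy
      exact h1 y hy.1 hy.2
    filter_upwards [Ioo_mem_nhds hx h12] with y hy
    rcases le_total y x with h | h
    · exact hmono.monotoneOn ⟨hy.1, h⟩ ⟨hx, le_rfl⟩ h
    · exact hanti.antitoneOn ⟨le_rfl, h12.le⟩ ⟨h, hy.2.le⟩ h

theorem isLocalMin_iff_of_deriv_sign (hx₁ : 0 < x₁) (h12 : x₁ < x₂)
    (hF : ∀ x, 0 < x → HasDerivAt F (F' x) x) (h1 : ∀ x, 0 < x → x < x₁ → 0 < F' x)
    (h2 : ∀ x, x₁ < x → x < x₂ → F' x < 0) (h3 : ∀ x, x₂ < x → 0 < F' x) {x : ℝ} (hx : 0 < x) :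
    IsLocalMin F x ↔ x = x₂ := by
  have hanti : StrictAntiOn F (Set.Icc x₁ x₂) := by
    refine strictAntiOn_of_hasDerivAt_neg (convex_Icc _ _) (fun y hy => hx₁.trans_le hy.1) hF ?_
    intro y hy
    rw [interior_Icc] at hy
    exact h2 y hy.1 hy.2
  constructor
  · intro h
    have h0 := h.hasDerivAt_eq_zero (hF x hx)
    rcases lt_trichotomy x x₂ with hlt | heq | hgt
    · rcases lt_trichotomy x x₁ with hlt2 | heq2 | hgt2
      · exact absurd h0 (h1 x hx hlt2).ne'
      · subst heq2
        have hev : ∀ᶠ y in 𝓝[>] x, F x ≤ F y ∧ y ∈ Set.Ioo x x₂ :=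
          (h.filter_mono nhdsWithin_le_nhds).and (Ioo_mem_nhdsGT h12)
        obtain ⟨y, hy1, hy2⟩ := hev.exists
        have := hanti ⟨le_rfl, h12.le⟩ ⟨hy2.1.le, hy2.2.le⟩ hy2.1
        linarith
      · exact absurd h0 (h2 x hgt2 hlt).ne
    · exact heq
    · exact absurd h0 (h3 x hgt).ne'
  · rintro rfl
    have hmono : StrictMonoOn F (Set.Ici x) := by
      refine strictMonoOn_of_hasDerivAt_pos (convex_Ici _) (fun y hy => hx.trans_le hy) hF ?_
      intro y hy
      rw [interior_Ici] at hy
      exact h3 y hy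
    filter_upwards [Ioi_mem_nhds h12] with y hy
    rcases le_total y x with h | h
    · exact hanti.antitoneOn ⟨le_of_lt hy, h⟩ ⟨h12.le, le_rfl⟩ h
    · exact hmono.monotoneOn Set.self_mem_Ici h h

/-- A function increasing on `(0, y]` exceeds its limit at `0⁺` there. -/
theorem lt_of_tendsto_of_strictMonoOn {c y : ℝ} (hl : Tendsto F (𝓝[>] 0) (𝓝 c))
    (hm : StrictMonoOn F (Set.Ioc 0 y)) {x : ℝ} (hx : x ∈ Set.Ioc 0 y) : c < F x := by
  have hx2 : x / 2 ∈ Set.Ioc 0 y := ⟨half_pos hx.1, (half_le_self hx.1.le).trans hx.2⟩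
  have h1 : c ≤ F (x / 2) := by
    refine le_of_tendsto hl ?_
    filter_upwards [Ioo_mem_nhdsGT (half_pos hx.1)] with t ht
    exact hm.monotoneOn ⟨ht.1, ht.2.le.trans hx2.2⟩ hx2 ht.2.le
  exact h1.trans_lt (hm hx2 hx (half_lt_self hx.1))

/-- `x (1 + coth x)` is squeezed between `x + 1` and `x + cosh x`, and `sech` tends to 1. -/
theorem tendsto_upperProfile (n : ℕ) :
    Tendsto (upperProfile n) (𝓝[>] 0) (𝓝 (2 * n)) := by
  have hs : Tendsto (fun x : ℝ => sech (n * x)) (𝓝[>] 0) (𝓝 1) := by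
    have hc : Continuous fun x : ℝ => sech (n * x) :=
      (continuous_iff_continuousAt.2 fun y => (hasDerivAt_sech y).continuousAt).comp
        (continuous_const.mul continuous_id)
    have := (hc.tendsto 0).mono_left (nhdsWithin_le_nhds (s := Set.Ioi 0))
    simpa [sech] using this
  have hx : Tendsto (fun x : ℝ => x * (1 + coth x)) (𝓝[>] 0) (𝓝 1) := by
    have hl : Tendsto (fun x : ℝ => x + 1) (𝓝[>] 0) (𝓝 1) := by
      have hc : Continuous fun x : ℝ => x + 1 := by fun_prop
      simpa using (hc.tendsto 0).mono_left (nhdsWithin_le_nhds (s := Set.Ioi 0))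
    have hu : Tendsto (fun x : ℝ => x + Real.cosh x) (𝓝[>] 0) (𝓝 1) := by
      have hc : Continuous fun x : ℝ => x + Real.cosh x := continuous_id.add Real.continuous_cosh
      simpa using (hc.tendsto 0).mono_left (nhdsWithin_le_nhds (s := Set.Ioi 0))
    refine tendsto_of_tendsto_of_tendsto_of_le_of_le' hl hu ?_ ?_
    · filter_upwards [self_mem_nhdsWithin] with x hx
      have hx0 : 0 < x := hx
      have := one_div_le_coth hx0
      rw [div_le_iff₀ hx0] at this
      nlinarith
    · filter_upwards [self_mem_nhdsWithin] with x hx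
      have hx0 : 0 < x := hx
      have h1 := Real.self_le_sinh_iff.2 hx0.le
      have h2 : x * coth x ≤ Real.cosh x := by
        rw [coth, ← mul_div_assoc, div_le_iff₀ (Real.sinh_pos_iff.2 hx0), mul_comm]
        have := Real.cosh_pos x
        gcongr
      linarith
  have h := (hx.mul (hs.const_add 1)).const_mul (n : ℝ)
  have e : (n : ℝ) * (1 * (1 + 1)) = 2 * n := by ring
  rw [e] at h
  refine h.congr fun x => ?_
  rw [upperProfile]
  ring

end

/-! ### Numerical estimates for `n = 8` and `n = 3` -/

theorem upperProfile_eight_half_lt : upperProfile 8 (1 / 2) < 2 * 8 := by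
  have h1 : coth (1 / 2) < 2.2 := by
    rw [coth_eq_one_add (by norm_num), mul_one_div_cancel two_ne_zero]
    have h := Real.exp_one_gt_d9
    have : 2 / (Real.exp 1 - 1) < 1.2 := by
      rw [div_lt_iff₀ (by linarith)]
      linarith
    linarith
  have h2 : sech 4 ≤ 1 / 9 := by
    refine one_div_le_one_div_of_le (by norm_num) ?_
    have := one_add_sq_div_two_le_cosh 4
    norm_num at this
    exact this
  have h3 := sech_pos 4
  have h4 := one_lt_coth (x := 1 / 2) (by norm_num)
  rw [upperProfile]
  norm_num at h1 h2 h4 ⊢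
  nlinarith

theorem cosh_le_chord {u v x : ℝ} (huv : u < v) (hx : x ∈ Set.Icc u v) :
    Real.cosh x ≤ Real.cosh u + (Real.cosh v - Real.cosh u) / (v - u) * (x - u) := by
  have hconv : ConvexOn ℝ Set.univ Real.cosh := by
    refine convexOn_univ_of_deriv2_nonneg Real.differentiable_cosh ?_ fun x => ?_
    · rw [Real.deriv_cosh]
      exact Real.differentiable_sinh
    · simp [Real.deriv_cosh, Real.deriv_sinh, (Real.cosh_pos x).le]
  have hd : 0 < v - u := sub_pos.2 huv
  have h := hconv.2 (Set.mem_univ u) (Set.mem_univ v)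
    (div_nonneg (sub_nonneg.2 hx.2) hd.le) (div_nonneg (sub_nonneg.2 hx.1) hd.le)
    (by field_simp; ring)
  simp only [smul_eq_mul] at h
  have e : (v - x) / (v - u) * u + (x - u) / (v - u) * v = x := by
    field_simp
    ring
  rw [e] at h
  refine h.trans_eq ?_
  field_simp
  ring

theorem cosh_three_lt : Real.cosh 3 < 10.0677 := by
  have h1 := Real.exp_one_lt_d9
  have h2 := Real.exp_one_gt_d9
  have e : Real.exp 3 = Real.exp 1 ^ 3 := by
    rw [← Real.exp_nat_mul]
    norm_num
  have h3 : Real.exp 3 < 20.08554 := by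
    rw [e]
    calc Real.exp 1 ^ 3 < 2.7182818286 ^ 3 := by gcongr
      _ < _ := by norm_num
  have h4 : 20.0855 < Real.exp 3 := by
    rw [e]
    calc _ < (2.7182818283 : ℝ) ^ 3 := by norm_num
      _ < _ := by gcongr
  have h5 : (Real.exp 3)⁻¹ < 0.0498 := by
    rw [inv_lt_comm₀ (by positivity) (by norm_num)]
    refine lt_trans ?_ h4
    norm_num
  rw [Real.cosh_eq, Real.exp_neg]
  linarith

theorem cosh_three_half_lt : Real.cosh (3 / 2) < 2.3525 := by
  have h := Real.cosh_two_mul (3 / 2)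
  rw [Real.sinh_sq] at h
  norm_num at h
  have := cosh_three_lt
  nlinarith [Real.cosh_pos (3 / 2)]

/-- Convexity puts `cosh` below its chords on `[0, 1]`, `[0, 3/2]` and `[3/2, 3]`, reducing the
claim to quadratics. The last one has a barely negative discriminant, hence the sharp decimals for
`cosh 3` and `cosh (3/2)`; 0.6414 is its vertex. -/
theorem one_sub_mul_cosh_lt {x : ℝ} (hx : 0 < x) (hx1 : x < 1) :
    (1 - x) * Real.cosh (3 * x) < 1 + x := by
  have hlow := cosh_three_half_lt
  rcases le_total x (1 / 3) with h | h
  · have hc := cosh_le_chord (u := 0) (v := 1) (x := 3 * x) one_pos ⟨by linarith, by linarith⟩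
    have h1 := cosh_one_lt
    rw [Real.cosh_zero] at hc
    have hb : Real.cosh (3 * x) ≤ 1 + 1.635 * x := by
      norm_num at hc h1 ⊢
      nlinarith
    have : (1 - x) * Real.cosh (3 * x) ≤ (1 - x) * (1 + 1.635 * x) :=
      mul_le_mul_of_nonneg_left hb (by linarith)
    nlinarith
  · rcases le_total x (1 / 2) with h' | h'
    · have hc := cosh_le_chord (u := 0) (v := 3 / 2) (x := 3 * x) (by norm_num)
        ⟨by linarith, by linarith⟩
      rw [Real.cosh_zero] at hc
      have hb : Real.cosh (3 * x) ≤ 1 + 2.705 * x := by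
        norm_num at hc hlow ⊢
        nlinarith
      have : (1 - x) * Real.cosh (3 * x) ≤ (1 - x) * (1 + 2.705 * x) :=
        mul_le_mul_of_nonneg_left hb (by linarith)
      nlinarith
    · have hc := cosh_le_chord (u := 3 / 2) (v := 3) (x := 3 * x) (by norm_num)
        ⟨by linarith, by linarith⟩
      have h3 := cosh_three_lt
      have hb : Real.cosh (3 * x) ≤ 2.3525 + 15.4304 * (x - 1 / 2) := by
        norm_num at hc hlow h3 ⊢
        nlinarith
      have : (1 - x) * Real.cosh (3 * x) ≤ (1 - x) * (2.3525 + 15.4304 * (x - 1 / 2)) :=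
        mul_le_mul_of_nonneg_left hb (by linarith)
      refine this.trans_lt ?_
      nlinarith [sq_nonneg (x - 0.6414)]

/-- As `x coth x ≥ 1`, it suffices that `(1 + x)(1 + sech 3x) > 2`. This is clear for `x ≥ 1` and
otherwise equivalent to `one_sub_mul_cosh_lt`. -/
theorem lt_upperProfile_three {x : ℝ} (hx : 0 < x) : 2 * (3 : ℕ) < upperProfile 3 x := by
  have h1 := one_div_le_coth hx
  rw [div_le_iff₀ hx] at h1
  have h2 := sech_pos (3 * x)
  have h3 : 2 < (1 + x) * (1 + sech (3 * x)) := by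
    rcases lt_or_ge x 1 with h | h
    · have hc := Real.cosh_pos (3 * x)
      have h4 := one_sub_mul_cosh_lt hx h
      rw [sech, ← sub_pos]
      have : (1 + x) * (1 + 1 / Real.cosh (3 * x)) - 2 =
          (1 + x - (1 - x) * Real.cosh (3 * x)) / Real.cosh (3 * x) := by
        field_simp
        ring
      rw [this]
      exact div_pos (by linarith) hc
    · nlinarith
  rw [upperProfile]
  push_cast
  have h5 : (1 + x) * (1 + sech (3 * x)) ≤ (x * (1 + coth x)) * (1 + sech (3 * x)) := by
    gcongr
    linarith
  linarith

/-! ### Transfer from `x = γa` to the frame bounds -/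

section

open Filter Topology

variable {a b : ℝ} {n : ℕ}

theorem hasDerivAt_upperBound₂ (ha : 0 < a) (hb : 0 < b) (hn : 0 < n) (hab : b⁻¹ = n * a)
    {γ : ℝ} (hγ : 0 < γ) :
    HasDerivAt (upperBound₂ a b)
      (n * (γ * a) * (1 + coth (γ * a)) * (1 + sech (n * (γ * a))) * upperRate n (γ * a) * a) γ := by
  have h1 := (hasDerivAt_upperProfile n (mul_pos hγ ha)).comp γ
    ((hasDerivAt_id γ).mul_const a)
  rw [one_mul] at h1
  refine h1.congr_of_eventuallyEq ?_
  filter_upwards [Ioi_mem_nhds hγ] with t ht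
  exact upperBound₂_eq ha hb ht hn hab

theorem hasDerivAt_lowerBound₂ (ha : 0 < a) (hb : 0 < b) (hn : 0 < n) (hab : b⁻¹ = n * a)
    {γ : ℝ} (hγ : 0 < γ) :
    HasDerivAt (lowerBound₂ a b)
      (n * (γ * a) * (coth (γ * a) - 1) * (1 - sech (n * (γ * a))) * lowerRate n (γ * a) * a) γ := by
  have h1 := (hasDerivAt_lowerProfile hn (mul_pos hγ ha)).comp γ
    ((hasDerivAt_id γ).mul_const a)
  rw [one_mul] at h1
  refine h1.congr_of_eventuallyEq ?_
  filter_upwards [Ioi_mem_nhds hγ] with t ht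
  exact lowerBound₂_eq ha hb ht hn hab

theorem tendsto_upperBound₂ (ha : 0 < a) (hb : 0 < b) (hn : 0 < n) (hab : b⁻¹ = n * a) :
    Tendsto (upperBound₂ a b) (𝓝[>] 0) (𝓝 (2 * n)) := by
  have h1 : Tendsto (fun γ : ℝ => γ * a) (𝓝[>] 0) (𝓝[>] 0) := by
    refine tendsto_nhdsWithin_iff.2 ⟨?_, ?_⟩
    · have hc : Continuous fun γ : ℝ => γ * a := by fun_prop
      simpa using (hc.tendsto 0).mono_left (nhdsWithin_le_nhds (s := Set.Ioi 0))
    · filter_upwards [self_mem_nhdsWithin] with γ hγ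
      exact mul_pos hγ ha
  refine ((tendsto_upperProfile n).comp h1).congr' ?_
  filter_upwards [self_mem_nhdsWithin] with γ hγ
  exact (upperBound₂_eq ha hb hγ hn hab).symm

theorem exists_lowerBound₂_max (ha : 0 < a) (hb : 0 < b) (hn : 0 < n) (hab : b⁻¹ = n * a) :
    ∃ γ₀ : ℝ, 0 < γ₀ ∧
      (∀ γ : ℝ, 0 < γ → γ ≠ γ₀ → lowerBound₂ a b γ < lowerBound₂ a b γ₀) ∧
      (∀ γ : ℝ, 0 < γ → (-1 + 1 / (γ * a) - coth (γ * a) =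
        -(n * coth (γ * n * a / 2) * sech (γ * n * a)) ↔ γ = γ₀)) := by
  obtain ⟨x₀, hx₀, hz⟩ := exists_lowerRate_zero hn
  have hanti := strictAntiOn_lowerRate hn
  have hγ₀ : 0 < x₀ / a := div_pos hx₀ ha
  refine ⟨x₀ / a, hγ₀, fun γ hγ hne => ?_, fun γ hγ => ?_⟩
  · refine lt_of_deriv_sign hγ₀ (fun t ht => hasDerivAt_lowerBound₂ ha hb hn hab ht)
      (fun t ht hlt => ?_) (fun t hlt => ?_) hγ hne
    · have hta := mul_pos ht ha
      have := hanti (Set.mem_Ioi.2 hta) (Set.mem_Ioi.2 hx₀) ((lt_div_iff₀ ha).1 hlt)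
      rw [hz] at this
      exact mul_pos (mul_pos (lowerProfile_factor_pos hn hta) this) ha
    · have hta := mul_pos (hγ₀.trans hlt) ha
      have := hanti (Set.mem_Ioi.2 hx₀) (Set.mem_Ioi.2 hta) ((div_lt_iff₀ ha).1 hlt)
      rw [hz] at this
      exact mul_neg_of_neg_of_pos
        (mul_neg_of_pos_of_neg (lowerProfile_factor_pos hn hta) this) ha
  · have e : -1 + 1 / (γ * a) - coth (γ * a) =
        -(n * coth (γ * n * a / 2) * sech (γ * n * a)) ↔ lowerRate n (γ * a) = 0 := by
      rw [lowerRate, show γ * a * n = γ * n * a by ring]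
      exact eq_neg_iff_add_eq_zero
    rw [e, eq_div_iff ha.ne', ← hz]
    exact hanti.injOn.eq_iff (Set.mem_Ioi.2 (mul_pos hγ ha)) (Set.mem_Ioi.2 hx₀)

theorem upperBound₂_of_rate_pos (ha : 0 < a) (hb : 0 < b) (hn : 0 < n) (hab : b⁻¹ = n * a)
    (hrate : ∀ x, 0 < x → 0 < upperRate n x) {γ : ℝ} (hγ : 0 < γ) :
    2 * (n : ℝ) < upperBound₂ a b γ ∧ 0 < deriv (upperBound₂ a b) γ := by
  have hd : ∀ t, 0 < t → 0 < n * (t * a) * (1 + coth (t * a)) * (1 + sech (n * (t * a))) *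
      upperRate n (t * a) * a := fun t ht =>
    mul_pos (mul_pos (upperProfile_factor_pos hn (mul_pos ht ha)) (hrate _ (mul_pos ht ha))) ha
  refine ⟨?_, ?_⟩
  · refine lt_of_tendsto_of_strictMonoOn (tendsto_upperBound₂ ha hb hn hab) (y := γ) ?_
      ⟨hγ, le_rfl⟩
    refine strictMonoOn_of_hasDerivAt_pos (convex_Ioc _ _) (fun y hy => hy.1)
      (fun t ht => hasDerivAt_upperBound₂ ha hb hn hab ht) fun t ht => ?_
    rw [interior_Ioc] at ht
    exact hd t ht.1
  · rw [(hasDerivAt_upperBound₂ ha hb hn hab hγ).deriv]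
    exact hd γ hγ

/-- The alternative in the conclusion reflects the two sides of `γmax`: up to it the bound increases
from its limit `2n`, and beyond it `γmin` gives the least value. Global minimality is thus a
comparison with `2n`. -/
theorem exists_upperBound₂_extrema (ha : 0 < a) (hb : 0 < b) (hn : 3 ≤ n) (hab : b⁻¹ = n * a) :
    ∃ γmax γmin : ℝ, 0 < γmax ∧
      γmax < Real.arcosh ((1 + Real.sqrt 5) / 2) / (n * a) ∧
      Real.arcosh ((1 + Real.sqrt 5) / 2) / (n * a) < γmin ∧
      (∀ γ : ℝ, 0 < γ → (IsLocalMax (upperBound₂ a b) γ ↔ γ = γmax)) ∧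
      (∀ γ : ℝ, 0 < γ → (IsLocalMin (upperBound₂ a b) γ ↔ γ = γmin)) ∧
      (∀ γ : ℝ, 0 < γ → 2 * (n : ℝ) < upperBound₂ a b γ ∨
        upperBound₂ a b γmin ≤ upperBound₂ a b γ) ∧
      (∀ γ : ℝ, γmin < γ → 0 < deriv (upperBound₂ a b) γ) := by
  have hn0 : 0 < n := by omega
  obtain ⟨x₁, x₂, hx₁, h1z, hz2, hr1, hr2, hr3⟩ := exists_upperRate_sign hn
  have h12 : x₁ / a < x₂ / a := div_lt_div_of_pos_right (h1z.trans hz2) ha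
  have hγ₁ : 0 < x₁ / a := div_pos hx₁ ha
  have hF := fun t (ht : 0 < t) => hasDerivAt_upperBound₂ ha hb hn0 hab ht
  have h1 : ∀ t, 0 < t → t < x₁ / a → 0 < n * (t * a) * (1 + coth (t * a)) *
      (1 + sech (n * (t * a))) * upperRate n (t * a) * a := fun t ht hlt =>
    mul_pos (mul_pos (upperProfile_factor_pos hn0 (mul_pos ht ha))
      (hr1 _ (mul_pos ht ha) ((lt_div_iff₀ ha).1 hlt))) ha
  have h2 : ∀ t, x₁ / a < t → t < x₂ / a → n * (t * a) * (1 + coth (t * a)) *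
      (1 + sech (n * (t * a))) * upperRate n (t * a) * a < 0 := fun t hgt hlt =>
    mul_neg_of_neg_of_pos (mul_neg_of_pos_of_neg
      (upperProfile_factor_pos hn0 (mul_pos (hγ₁.trans hgt) ha))
      (hr2 _ ((div_lt_iff₀ ha).1 hgt) ((lt_div_iff₀ ha).1 hlt))) ha
  have h3 : ∀ t, x₂ / a < t → 0 < n * (t * a) * (1 + coth (t * a)) *
      (1 + sech (n * (t * a))) * upperRate n (t * a) * a := fun t hgt =>
    mul_pos (mul_pos (upperProfile_factor_pos hn0 (mul_pos ((hγ₁.trans h12).trans hgt) ha))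
      (hr3 _ ((div_lt_iff₀ ha).1 hgt))) ha
  refine ⟨x₁ / a, x₂ / a, hγ₁, ?_, ?_,
    fun γ hγ => isLocalMax_iff_of_deriv_sign hγ₁ h12 hF h1 h2 h3 hγ,
    fun γ hγ => isLocalMin_iff_of_deriv_sign hγ₁ h12 hF h1 h2 h3 hγ, fun γ hγ => ?_,
    fun γ hγ => ?_⟩
  · rw [← div_div]
    exact div_lt_div_of_pos_right h1z ha
  · rw [← div_div]
    exact div_lt_div_of_pos_right hz2 ha
  · rcases le_total γ (x₁ / a) with h | h
    · left
      refine lt_of_tendsto_of_strictMonoOn (tendsto_upperBound₂ ha hb hn0 hab) (y := x₁ / a) ?_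
        ⟨hγ, h⟩
      refine strictMonoOn_of_hasDerivAt_pos (convex_Ioc _ _) (fun y hy => hy.1) hF fun t ht => ?_
      rw [interior_Ioc] at ht
      exact h1 t ht.1 ht.2
    · right
      rcases le_total γ (x₂ / a) with h' | h'
      · refine (strictAntiOn_of_hasDerivAt_neg (convex_Icc (x₁ / a) (x₂ / a))
          (fun y hy => hγ₁.trans_le hy.1) hF fun t ht => ?_).antitoneOn ⟨h, h'⟩ ⟨h12.le, le_rfl⟩ h'
        rw [interior_Icc] at ht
        exact h2 t ht.1 ht.2
      · refine (strictMonoOn_of_hasDerivAt_pos (convex_Ici (x₂ / a))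
          (fun y hy => (hγ₁.trans h12).trans_le hy) hF fun t ht => ?_).monotoneOn
          Set.self_mem_Ici h' h'
        rw [interior_Ici] at ht
        exact h3 t ht
  · rw [(hF γ ((hγ₁.trans h12).trans hγ)).deriv]
    exact h3 γ hγ

end

end CutoffGabor

theorem proposition2p4 :
    (∀ (a b : ℝ) (n : ℕ), 0 < a → 0 < b → (a * b)⁻¹ = (n : ℝ) →
      -- the system is a frame with these bounds
      (∀ γ : ℝ, 0 < γ →
        0 < CutoffGabor.lowerBound₂ a b γ ∧
        CutoffGabor.IsLowerFrameBound (CutoffGabor.cutoffExp 2 b γ) a b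
          (CutoffGabor.lowerBound₂ a b γ) ∧
        CutoffGabor.IsUpperFrameBound (CutoffGabor.cutoffExp 2 b γ) a b
          (CutoffGabor.upperBound₂ a b γ)) ∧
      -- (i)
      (∃ γ₀ : ℝ, 0 < γ₀ ∧
        (∀ γ : ℝ, 0 < γ → γ ≠ γ₀ →
          CutoffGabor.lowerBound₂ a b γ < CutoffGabor.lowerBound₂ a b γ₀) ∧
        (∀ γ : ℝ, 0 < γ →
          (-1 + 1 / (γ * a) - CutoffGabor.coth (γ * a) =
              -(n * CutoffGabor.coth (γ * n * a / 2) * CutoffGabor.sech (γ * n * a)) ↔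
            γ = γ₀))) ∧
      -- (ii)
      (n = 1 ∨ n = 2 → ∀ γ : ℝ, 0 < γ →
        2 * (n : ℝ) < CutoffGabor.upperBound₂ a b γ ∧
        0 < deriv (CutoffGabor.upperBound₂ a b) γ) ∧
      -- (iii)
      (3 ≤ n → ∃ γmax γmin : ℝ, 0 < γmax ∧
        γmax < Real.arcosh ((1 + Real.sqrt 5) / 2) / (n * a) ∧
        Real.arcosh ((1 + Real.sqrt 5) / 2) / (n * a) < γmin ∧
        (∀ γ : ℝ, 0 < γ → (IsLocalMax (CutoffGabor.upperBound₂ a b) γ ↔ γ = γmax)) ∧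
        (∀ γ : ℝ, 0 < γ → (IsLocalMin (CutoffGabor.upperBound₂ a b) γ ↔ γ = γmin)) ∧
        (CutoffGabor.upperBound₂ a b γmin < 2 * (n : ℝ) →
          ∀ γ : ℝ, 0 < γ →
            CutoffGabor.upperBound₂ a b γmin ≤ CutoffGabor.upperBound₂ a b γ) ∧
        (∀ γ : ℝ, γmin < γ → 0 < deriv (CutoffGabor.upperBound₂ a b) γ))) ∧
    -- for `n ≥ 3` a global minimum over `γ > 0` may exist
    (∃ (a b : ℝ) (n : ℕ), 0 < a ∧ 0 < b ∧ (a * b)⁻¹ = (n : ℝ) ∧ 3 ≤ n ∧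
      ∃ γ₁ : ℝ, 0 < γ₁ ∧ ∀ γ : ℝ, 0 < γ →
        CutoffGabor.upperBound₂ a b γ₁ ≤ CutoffGabor.upperBound₂ a b γ) ∧
    -- and it may fail to exist
    (∃ (a b : ℝ) (n : ℕ), 0 < a ∧ 0 < b ∧ (a * b)⁻¹ = (n : ℝ) ∧ 3 ≤ n ∧
      ¬ ∃ γ₁ : ℝ, 0 < γ₁ ∧ ∀ γ : ℝ, 0 < γ →
        CutoffGabor.upperBound₂ a b γ₁ ≤ CutoffGabor.upperBound₂ a b γ) := by

  refine ⟨fun a b n ha hb h => ?_, ?_, ?_⟩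
  · have hn : 0 < n := by
      have : 0 < (a * b)⁻¹ := by positivity
      rw [h] at this
      exact_mod_cast this
    have hab : b⁻¹ = n * a := by
      rw [← h]
      field_simp
    refine ⟨fun γ hγ => ⟨?_, ?_, ?_⟩,
      CutoffGabor.exists_lowerBound₂_max ha hb hn hab, ?_, fun hn3 => ?_⟩
    · rw [CutoffGabor.lowerBound₂_eq ha hb hγ hn hab]
      exact CutoffGabor.lowerProfile_factor_pos hn (mul_pos hγ ha)
    · rw [CutoffGabor.lowerBound₂_eq ha hb hγ hn hab]
      exact (CutoffGabor.isGreatest_lowerFrameBounds ha hb hγ hn hab).1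
    · rw [CutoffGabor.upperBound₂_eq ha hb hγ hn hab]
      exact (CutoffGabor.isLeast_upperFrameBounds ha hb hγ hn hab).1
    · rintro (rfl | rfl) γ hγ
      · exact CutoffGabor.upperBound₂_of_rate_pos ha hb hn hab
          (fun _ => CutoffGabor.upperRate_one_pos) hγ
      · exact CutoffGabor.upperBound₂_of_rate_pos ha hb hn hab
          (fun _ => CutoffGabor.upperRate_two_pos) hγ
    · obtain ⟨γmax, γmin, h1, h2, h3, h4, h5, h6, h7⟩ :=
        CutoffGabor.exists_upperBound₂_extrema ha hb hn3 hab
      refine ⟨γmax, γmin, h1, h2, h3, h4, h5, fun hlt γ hγ => ?_, h7⟩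
      rcases h6 γ hγ with h | h
      · exact (hlt.trans h).le
      · exact h
  -- For `n = 8` the value at `γ = 1/2` is already below `2n = 16`, so the value at `γmin` is too.
  · have hab : (1 / 8 : ℝ)⁻¹ = (8 : ℕ) * 1 := by norm_num
    obtain ⟨γmax, γmin, h1, h2, h3, -, -, h6, -⟩ :=
      CutoffGabor.exists_upperBound₂_extrema one_pos (by norm_num) (by norm_num) hab
    refine ⟨1, 1 / 8, 8, one_pos, by norm_num, by norm_num, by norm_num, γmin,
      h1.trans (h2.trans h3), fun γ hγ => ?_⟩
    have hval : CutoffGabor.upperBound₂ 1 (1 / 8) (1 / 2) < 2 * (8 : ℕ) := by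
      rw [CutoffGabor.upperBound₂_eq one_pos (by norm_num) (by norm_num) (by norm_num) hab, mul_one]
      exact_mod_cast CutoffGabor.upperProfile_eight_half_lt
    have hmin := (h6 (1 / 2) (by norm_num)).resolve_left (not_lt.2 hval.le)
    rcases h6 γ hγ with h | h
    · exact ((hmin.trans_lt hval).trans h).le
    · exact h
  · have hab : (1 / 3 : ℝ)⁻¹ = (3 : ℕ) * 1 := by norm_num
    refine ⟨1, 1 / 3, 3, one_pos, by norm_num, by norm_num, le_rfl, ?_⟩
    rintro ⟨γ₁, hγ₁, hmin⟩
    have hgt : 2 * ((3 : ℕ) : ℝ) < CutoffGabor.upperBound₂ 1 (1 / 3) γ₁ := by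
      rw [CutoffGabor.upperBound₂_eq one_pos (by norm_num) hγ₁ (by norm_num) hab, mul_one]
      exact CutoffGabor.lt_upperProfile_three hγ₁
    -- A global minimum would be at most the limit 6 at `0⁺`, but for `n = 3` every value exceeds 6.
    have hle := ge_of_tendsto
      (CutoffGabor.tendsto_upperBound₂ one_pos (by norm_num) (by norm_num) hab)
      (Filter.eventually_of_mem self_mem_nhdsWithin fun γ hγ => hmin γ hγ)
    exact absurd hgt (not_lt.2 hle)
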